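/- Let $N\ge 3$, let $\Omega\subset\mathbb{R}^N$ be a bounded domain (nonempty, open, connected), and let $0\le h\in L^1_{\mathrm{loc}}(\Omega)$ with $h\not\equiv 0$ (a.e.). Let $g:\Omega\times(0,+\infty)\to\mathbb{R}$ be a Carathéodory function (i.e. $g(\cdot,s)$ is measurable for every $s>0$ and $g(x,\cdot)$ is continuous for a.e. $x\in\Omega$) such that the function $s\mapsto s\,g(x,s)$ is nondecreasing on $(0,+\infty)$ for a.e. $x\in\Omega$ and such that, for some $\sigma\in(0,1)$ and some continuous function $g_0:(0,+\infty)\to\mathbb{R}$, $$-g_0(s)\le g(x,s)\le \frac{\sigma}{s}\qquad\text{for a.e. }x\in\Omega\text{ and all }s>0.$$ Let $u,v\in C(\Omega)\cap W^{1,N}_{\mathrm{loc}}(\Omega)$ satisfy $u,v>0$ in $\Omega$ and $$\int_\Omega\nabla u\cdot\nabla\phi+\int_\Omega g(x,u)|\nabla u|^2\phi\le\int_\Omega h\,\phi,\qquad \int_\Omega\nabla v\cdot\nabla\phi+\int_\Omega g(x,v)|\nabla v|^2\phi\ge\int_\Omega h\,\phi$$ for every $0\le\phi\in H^1_0(\Omega)\cap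 L^\infty(\Omega)$ with compact support in $\Omega$. Suppose also that $$\limsup_{\Omega\ni x\to x_0}\bigl(u(x)^{1-\sigma}-v(x)^{1-\sigma}\bigr)\le 0\qquad\text{for every }x_0\in\partial\Omega.$$ Then $u\le v$ in $\Omega$. -/

import Mathlib

open MeasureTheory Set Filter Topology
open scoped ENNReal ContDiff Gradient

/-- `ψ ∈ C_c^∞(Ω)`: smooth, with compact support contained in the open set `Ω`. -/
structure IsCcSmooth {N : ℕ} (Ω : Set (EuclideanSpace ℝ (Fin N)))
    (ψ : EuclideanSpace ℝ (Fin N) → ℝ) : Prop where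
  smooth : ContDiff ℝ ∞ ψ
  compactSupport : HasCompactSupport ψ
  support_subset : tsupport ψ ⊆ Ω

/-- `Dw` is the (distributional) weak gradient of `w` in the open set `Ω`; it is unique up to
a.e. equality in `Ω`. Values of `w` and `Dw` outside `Ω` are irrelevant. -/
structure HasWeakGradient {N : ℕ} (Ω : Set (EuclideanSpace ℝ (Fin N)))
    (w : EuclideanSpace ℝ (Fin N) → ℝ)
    (Dw : EuclideanSpace ℝ (Fin N) → EuclideanSpace ℝ (Fin N)) : Prop where
  locallyIntegrable : LocallyIntegrableOn w Ω volume
  locallyIntegrable_grad : LocallyIntegrableOn Dw Ω volume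
  integral_eq : ∀ ψ : EuclideanSpace ℝ (Fin N) → ℝ, IsCcSmooth Ω ψ → ∀ i : Fin N,
    ∫ x in Ω, w x * fderiv ℝ ψ x (EuclideanSpace.single i 1) = -∫ x in Ω, Dw x i * ψ x

/-- `w ∈ L^p_loc(Ω)`: `w` is in `L^p(K)` for every compact `K ⊆ Ω`. -/
def MemLpLoc {N : ℕ} {F : Type*} [NormedAddCommGroup F] (Ω : Set (EuclideanSpace ℝ (Fin N)))
    (p : ℝ≥0∞) (w : EuclideanSpace ℝ (Fin N) → F) : Prop :=
  ∀ K : Set (EuclideanSpace ℝ (Fin N)), IsCompact K → K ⊆ Ω → MemLp w p (volume.restrict K)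

/-- `w ∈ W^{1,p}_loc(Ω)`, with weak gradient `Dw`. -/
structure MemW1pLoc {N : ℕ} (Ω : Set (EuclideanSpace ℝ (Fin N))) (p : ℝ≥0∞)
    (w : EuclideanSpace ℝ (Fin N) → ℝ)
    (Dw : EuclideanSpace ℝ (Fin N) → EuclideanSpace ℝ (Fin N)) : Prop where
  hasWeakGradient : HasWeakGradient Ω w Dw
  memLpLoc : MemLpLoc Ω p w
  memLpLoc_grad : MemLpLoc Ω p Dw

/-- `w ∈ H_0^1(Ω)`, with weak gradient `Dw`: `w` is in `H^1(Ω)` and it is a limit, in the norm of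
`H^1(Ω)`, of functions in `C_c^∞(Ω)`. -/
structure MemH10 {N : ℕ} (Ω : Set (EuclideanSpace ℝ (Fin N)))
    (w : EuclideanSpace ℝ (Fin N) → ℝ)
    (Dw : EuclideanSpace ℝ (Fin N) → EuclideanSpace ℝ (Fin N)) : Prop where
  hasWeakGradient : HasWeakGradient Ω w Dw
  memLp : MemLp w 2 (volume.restrict Ω)
  memLp_grad : MemLp Dw 2 (volume.restrict Ω)
  exists_approx : ∃ ψ : ℕ → EuclideanSpace ℝ (Fin N) → ℝ, (∀ n, IsCcSmooth Ω (ψ n)) ∧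
    Tendsto (fun n => eLpNorm (fun x => w x - ψ n x) 2 (volume.restrict Ω)) atTop (𝓝 0) ∧
    Tendsto (fun n => eLpNorm (fun x => Dw x - ∇ (ψ n) x) 2 (volume.restrict Ω)) atTop (𝓝 0)

/-- `0 ≤ φ ∈ H_0^1(Ω) ∩ L^∞(Ω)` with compact support in `Ω`, and `Dφ` is its weak gradient. -/
structure IsAdmissibleTest {N : ℕ} (Ω : Set (EuclideanSpace ℝ (Fin N)))
    (φ : EuclideanSpace ℝ (Fin N) → ℝ)
    (Dφ : EuclideanSpace ℝ (Fin N) → EuclideanSpace ℝ (Fin N)) : Prop where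
  memH10 : MemH10 Ω φ Dφ
  memLinfty : MemLp φ ⊤ (volume.restrict Ω)
  nonneg : ∀ᵐ x ∂(volume.restrict Ω), 0 ≤ φ x
  compactSupport : ∃ K : Set (EuclideanSpace ℝ (Fin N)), IsCompact K ∧ K ⊆ Ω ∧
    ∀ᵐ x ∂(volume.restrict Ω), x ∉ K → φ x = 0

/-- `g : Ω × (0,+∞) → ℝ` is a Carathéodory function: (Lebesgue) measurable in `x ∈ Ω` for every
`s > 0`, and continuous in `s ∈ (0,+∞)` for a.e. `x ∈ Ω`. -/
structure IsCaratheodoryFun {N : ℕ} (Ω : Set (EuclideanSpace ℝ (Fin N)))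
    (g : EuclideanSpace ℝ (Fin N) → ℝ → ℝ) : Prop where
  aemeasurable : ∀ s : ℝ, 0 < s → AEMeasurable (fun x => g x s) (volume.restrict Ω)
  continuousOn : ∀ᵐ x ∂(volume.restrict Ω), ContinuousOn (g x) (Ioi 0)

/-- Weak form of `-Δw + g(x,w)|∇w|² ≤ h` in `Ω`, where `Dw` is the weak gradient of `w`. -/
def IsWeakSubsolution {N : ℕ} (Ω : Set (EuclideanSpace ℝ (Fin N)))
    (g : EuclideanSpace ℝ (Fin N) → ℝ → ℝ) (h w : EuclideanSpace ℝ (Fin N) → ℝ)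
    (Dw : EuclideanSpace ℝ (Fin N) → EuclideanSpace ℝ (Fin N)) : Prop :=
  ∀ φ Dφ, IsAdmissibleTest Ω φ Dφ →
    (∫ x in Ω, inner ℝ (Dw x) (Dφ x)) + (∫ x in Ω, g x (w x) * ‖Dw x‖ ^ 2 * φ x)
      ≤ ∫ x in Ω, h x * φ x

/-- Weak form of `-Δw + g(x,w)|∇w|² ≥ h` in `Ω`, where `Dw` is the weak gradient of `w`. -/
def IsWeakSupersolution {N : ℕ} (Ω : Set (EuclideanSpace ℝ (Fin N)))
    (g : EuclideanSpace ℝ (Fin N) → ℝ → ℝ) (h w : EuclideanSpace ℝ (Fin N) → ℝ)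
    (Dw : EuclideanSpace ℝ (Fin N) → EuclideanSpace ℝ (Fin N)) : Prop :=
  ∀ φ Dφ, IsAdmissibleTest Ω φ Dφ →
    ∫ x in Ω, h x * φ x ≤
      (∫ x in Ω, inner ℝ (Dw x) (Dφ x)) + (∫ x in Ω, g x (w x) * ‖Dw x‖ ^ 2 * φ x)

/-! Put z = u^(1-σ) - v^(1-σ) and suppose z > 0 somewhere. By the boundary condition the sets {z ≥
ε}, ε > 0, are compact, so z has a maximum M > 0, and for ε ≤ k < M the truncation f = (z - k)⁺ has
compact support in Ω.

Write P = u^(-σ) ∇u and Q = v^(-σ) ∇v, so that ∇z = (1-σ)(P - Q). Testing the inequality for u with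
u^(-σ) f³ turns its quadratic gradient term into -f³ H(u)|P|², where H(s) = s^(σ-1)(σ - s g(x,s));
likewise for v, with Q. The hypotheses on g say exactly that σ - s g(x,s) is nonnegative and
nonincreasing at the values that matter, so H(u) ≤ H(v) where u > v. There u^(-σ) ≤ v^(-σ) as well,
so h ≥ 0 gives its term the favourable sign. Subtracting, and using |P|² - |Q|² ≤ (|P| + |Q|)|P -
Q|, leaves an inequality for w = f² with a linear drift: (3/4) ∫|∇w|² ≤ (1/2) ∫ b w |∇w|, with b =
H(v)(|P| + |Q|) in L^N_loc.

By Hölder and Sobolev the right side is at most (1/2) C ‖b‖_N ‖∇w‖₂². Only b on {k < z < M} counts,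
because ∇z = 0 a.e. on {z = M}. These sets decrease to the empty set as k increases to M, so C ‖b‖_N
≤ 1 for a suitable k; then ∇w = 0, hence w = 0, which contradicts z = M > k at a maximum point.

The two inequalities carrying this are `comparison_energy` (from `comparison_pointwise`) and
`MemH10.ae_eq_zero_of_drift`. The calculus of weak gradients behind them (C¹ chain rule, vanishing
on level sets, membership in H¹₀) rests on mollification. -/

/-! ### Mollification in L^p -/

section Mollification

open scoped Convolution
open ContinuousLinearMap

variable {E F : Type*} [NormedAddCommGroup E] [NormedSpace ℝ E] [FiniteDimensional ℝ E]
  [MeasurableSpace E] [BorelSpace E] [NormedAddCommGroup F] [NormedSpace ℝ F]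
  {μ : Measure E}

/-- Jensen's inequality for the convolution with a probability density. -/
theorem enorm_convolution_rpow_le {ρ : E → ℝ} (hρ : Continuous ρ) (hρ0 : ∀ x, 0 ≤ ρ x)
    (hρi : Integrable ρ μ) (hρ1 : ∫ x, ρ x ∂μ = 1) {f : E → F} (hf : StronglyMeasurable f)
    {p : ℝ} (hp : 1 ≤ p) (x : E) :
    ‖(ρ ⋆[lsmul ℝ ℝ, μ] f) x‖ₑ ^ p ≤ ∫⁻ t, ENNReal.ofReal (ρ t) * ‖f (x - t)‖ₑ ^ p ∂μ := by
  have hm : Measurable fun t => ENNReal.ofReal (ρ t) := by fun_prop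
  have hfm : Measurable fun t => ‖f (x - t)‖ₑ :=
    (hf.comp_measurable (measurable_const.sub measurable_id)).enorm
  -- With ρ as density of a probability measure, the bound is the monotonicity of L^q norms in q,
  -- between 1 and p.
  set ν := μ.withDensity fun t => ENNReal.ofReal (ρ t) with hν
  have : IsProbabilityMeasure ν := ⟨by
    rw [hν, withDensity_apply _ MeasurableSet.univ, setLIntegral_univ,
      ← ofReal_integral_eq_lintegral_ofReal hρi (ae_of_all _ hρ0), hρ1, ENNReal.ofReal_one]⟩
  have h1 : ‖(ρ ⋆[lsmul ℝ ℝ, μ] f) x‖ₑ ≤ ∫⁻ t, ‖f (x - t)‖ₑ ∂ν := by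
    rw [convolution_def, hν, lintegral_withDensity_eq_lintegral_mul _ hm hfm]
    refine (enorm_integral_le_lintegral_enorm _).trans (lintegral_mono fun t => ?_)
    simp [enorm_smul, Real.enorm_of_nonneg (hρ0 t)]
  have h2 := eLpNorm'_le_eLpNorm'_of_exponent_le (μ := ν) one_pos hp
    (f := fun t => f (x - t))
    (hf.comp_measurable (measurable_const.sub measurable_id)).aestronglyMeasurable
  simp only [eLpNorm', ENNReal.rpow_one, div_one] at h2
  calc ‖(ρ ⋆[lsmul ℝ ℝ, μ] f) x‖ₑ ^ p ≤ ((∫⁻ t, ‖f (x - t)‖ₑ ^ p ∂ν) ^ (1 / p)) ^ p := by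
        gcongr
        exact h1.trans h2
    _ = ∫⁻ t, ‖f (x - t)‖ₑ ^ p ∂ν := by
        rw [← ENNReal.rpow_mul, one_div_mul_cancel (by positivity), ENNReal.rpow_one]
    _ = _ := by
        rw [hν, lintegral_withDensity_eq_lintegral_mul _ hm (hfm.pow_const p)]
        rfl

variable [μ.IsAddHaarMeasure]

/-- Young's inequality for the convolution with a probability density. -/
theorem eLpNorm_convolution_le {ρ : E → ℝ} (hρ : Continuous ρ) (hρ0 : ∀ x, 0 ≤ ρ x)
    (hρi : Integrable ρ μ) (hρ1 : ∫ x, ρ x ∂μ = 1) {f : E → F} (hf : AEStronglyMeasurable f μ)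
    {p : ℝ≥0∞} (hp : 1 ≤ p) (hp' : p ≠ ⊤) :
    eLpNorm (ρ ⋆[lsmul ℝ ℝ, μ] f) p μ ≤ eLpNorm f p μ := by
  wlog hf' : StronglyMeasurable f generalizing f
  · rw [eLpNorm_congr_ae hf.ae_eq_mk, convolution_congr _ (EventuallyEq.refl _ ρ) hf.ae_eq_mk]
    exact this hf.stronglyMeasurable_mk.aestronglyMeasurable hf.stronglyMeasurable_mk
  have hp0 : p ≠ 0 := (one_pos.trans_le hp).ne'
  have hpr : 1 ≤ p.toReal := by simpa using ENNReal.toReal_mono hp' hp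
  rw [eLpNorm_eq_lintegral_rpow_enorm_toReal hp0 hp', eLpNorm_eq_lintegral_rpow_enorm_toReal hp0 hp']
  gcongr ?_ ^ _
  have hm : Measurable fun t => ENNReal.ofReal (ρ t) := by fun_prop
  have hfm : Measurable fun t => ‖f t‖ₑ ^ p.toReal := hf'.enorm.pow_const _
  calc ∫⁻ x, ‖(ρ ⋆[lsmul ℝ ℝ, μ] f) x‖ₑ ^ p.toReal ∂μ
      ≤ ∫⁻ x, ∫⁻ t, ENNReal.ofReal (ρ t) * ‖f (x - t)‖ₑ ^ p.toReal ∂μ ∂μ :=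
        lintegral_mono fun x => enorm_convolution_rpow_le hρ hρ0 hρi hρ1 hf' hpr x
    _ = ∫⁻ t, ∫⁻ x, ENNReal.ofReal (ρ t) * ‖f (x - t)‖ₑ ^ p.toReal ∂μ ∂μ := by
        refine lintegral_lintegral_swap (Measurable.aemeasurable ?_)
        exact (hm.comp measurable_snd).mul (hfm.comp (measurable_fst.sub measurable_snd))
    _ = ∫⁻ t, ENNReal.ofReal (ρ t) * ∫⁻ x, ‖f x‖ₑ ^ p.toReal ∂μ ∂μ := by
        refine lintegral_congr fun t => ?_
        rw [lintegral_const_mul _ (f := fun x => ‖f (x - t)‖ₑ ^ p.toReal)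
            (hfm.comp (measurable_id.sub_const t)),
          lintegral_sub_right_eq_self (fun x => ‖f x‖ₑ ^ p.toReal) t]
    _ = ∫⁻ x, ‖f x‖ₑ ^ p.toReal ∂μ := by
        rw [lintegral_mul_const _ hm, ← ofReal_integral_eq_lintegral_ofReal hρi (ae_of_all _ hρ0),
          hρ1, ENNReal.ofReal_one, one_mul]

variable (E) in
/-- A sequence of bump functions whose supports shrink to the origin. -/
noncomputable def shrinkingBump (n : ℕ) : ContDiffBump (0 : E) where
  rIn := 1 / (2 * (n + 1))
  rOut := 1 / (n + 1)
  rIn_pos := by positivity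
  rIn_lt_rOut := by
    apply one_div_lt_one_div_of_lt <;> linarith [(Nat.cast_nonneg n : (0 : ℝ) ≤ n)]

/-- The mollifications of `f`. -/
noncomputable def mollify (μ : Measure E) (n : ℕ) (f : E → F) : E → F :=
  (shrinkingBump E n).normed μ ⋆[lsmul ℝ ℝ, μ] f

theorem contDiff_mollify (n : ℕ) {f : E → F} (hf : LocallyIntegrable f μ) [CompleteSpace F] :
    ContDiff ℝ ∞ (mollify μ n f) :=
  HasCompactSupport.contDiff_convolution_left _ (shrinkingBump E n).hasCompactSupport_normed
    (shrinkingBump E n).contDiff_normed hf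

theorem hasCompactSupport_mollify (n : ℕ) {f : E → F} (hf : HasCompactSupport f) :
    HasCompactSupport (mollify μ n f) :=
  HasCompactSupport.convolution _ (shrinkingBump E n).hasCompactSupport_normed hf

theorem tsupport_mollify_subset (n : ℕ) (f : E → F) :
    tsupport (mollify μ n f) ⊆ Metric.cthickening (1 / (n + 1)) (tsupport f) := by
  refine closure_minimal ?_ Metric.isClosed_cthickening
  refine (support_convolution_subset _).trans ?_
  rintro x ⟨a, ha, b, hb, rfl⟩
  rw [ContDiffBump.support_normed_eq, mem_ball_zero_iff] at ha
  replace ha : ‖a‖ < 1 / (n + 1) := ha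
  refine Metric.mem_cthickening_of_dist_le _ b _ _ (subset_tsupport f hb) ?_
  simpa [dist_eq_norm] using ha.le

theorem tendstoUniformly_mollify [CompleteSpace F] {f : E → F} (hf : Continuous f)
    (hf' : HasCompactSupport f) :
    TendstoUniformly (fun n => mollify μ n f) f atTop := by
  rw [Metric.tendstoUniformly_iff]
  intro ε hε
  obtain ⟨δ, hδ, h⟩ := Metric.uniformContinuous_iff.1
    (hf'.uniformContinuous_of_continuous hf) (ε / 2) (half_pos hε)
  filter_upwards [(tendsto_order.1 (tendsto_one_div_add_atTop_nhds_zero_nat (𝕜 := ℝ))).2 δ hδ]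
    with n hn x
  rw [dist_comm]
  refine (ContDiffBump.dist_normed_convolution_le hf.aestronglyMeasurable fun y hy => ?_).trans_lt
    (half_lt_self hε)
  exact (h ((Metric.mem_ball.1 hy).trans hn)).le

theorem mollify_sub (n : ℕ) {f g : E → F} (hf : LocallyIntegrable f μ)
    (hg : LocallyIntegrable g μ) : mollify μ n (f - g) = mollify μ n f - mollify μ n g := by
  have h : ∀ {f : E → F}, LocallyIntegrable f μ →
      ConvolutionExists ((shrinkingBump E n).normed μ) f (lsmul ℝ ℝ) μ := fun hf =>
    HasCompactSupport.convolutionExists_left _ (shrinkingBump E n).hasCompactSupport_normed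
      ((shrinkingBump E n).contDiff_normed (n := 0)).continuous hf
  have hneg : mollify μ n (-g) = - mollify μ n g := by
    simpa using! convolution_smul (L := lsmul ℝ ℝ) (μ := μ)
      (f := (shrinkingBump E n).normed μ) (g := g) (y := (-1 : ℝ))
  rw [sub_eq_add_neg, sub_eq_add_neg, ← hneg]
  exact (h hf).distrib_add (h hg.neg)

theorem eLpNorm_mollify_le (n : ℕ) {f : E → F} (hf : AEStronglyMeasurable f μ)
    {p : ℝ≥0∞} (hp : 1 ≤ p) (hp' : p ≠ ⊤) : eLpNorm (mollify μ n f) p μ ≤ eLpNorm f p μ :=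
  eLpNorm_convolution_le ((shrinkingBump E n).contDiff_normed (n := 0)).continuous
    (shrinkingBump E n).nonneg_normed (shrinkingBump E n).integrable_normed
    (shrinkingBump E n).integral_normed hf hp hp'

theorem tendsto_eLpNorm_sub_mollify_of_continuous [CompleteSpace F] {f : E → F}
    (hf : Continuous f) (hf' : HasCompactSupport f) {p : ℝ≥0∞} (hp' : p ≠ ⊤) :
    Tendsto (fun n => eLpNorm (f - mollify μ n f) p μ) atTop (𝓝 0) := by
  -- All mollification radii are at most 1, so this compact set contains every support and uniform
  -- convergence gives L^p convergence.
  set K := Metric.cthickening 1 (tsupport f) with hK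
  have hKc : IsCompact K := hf'.isCompact.cthickening
  have hμK : μ K ^ (1 / p.toReal) ≠ ⊤ := ENNReal.rpow_ne_top_of_nonneg (by positivity)
    hKc.measure_lt_top.ne
  have hlim : Tendsto (fun δ : ℝ => ENNReal.ofReal δ * μ K ^ (1 / p.toReal)) (𝓝[>] 0) (𝓝 0) := by
    have : Tendsto (fun δ : ℝ => ENNReal.ofReal δ * μ K ^ (1 / p.toReal)) (𝓝 0)
        (𝓝 (ENNReal.ofReal 0 * μ K ^ (1 / p.toReal))) :=
      ENNReal.Tendsto.mul_const (ENNReal.tendsto_ofReal tendsto_id) (Or.inr hμK)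
    rw [ENNReal.ofReal_zero, zero_mul] at this
    exact this.mono_left nhdsWithin_le_nhds
  rw [ENNReal.tendsto_atTop_zero]
  intro ε hε
  obtain ⟨δ, hδ1, hδ⟩ := ((hlim.eventually (gt_mem_nhds hε)).and self_mem_nhdsWithin).exists
  obtain ⟨n₀, hn₀⟩ := eventually_atTop.1
    (Metric.tendstoUniformly_iff.1 (tendstoUniformly_mollify (μ := μ) hf hf') δ hδ)
  refine ⟨n₀, fun n hn => (eLpNorm_sub_le_of_dist_bdd μ hp' hKc.measurableSet (le_of_lt hδ)
    (fun x => (hn₀ n hn x).le) ?_ ?_).trans hδ1.le⟩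
  · exact (subset_tsupport f).trans (Metric.self_subset_cthickening _)
  · refine (subset_tsupport _).trans ((tsupport_mollify_subset n f).trans
      (Metric.cthickening_mono ?_ _))
    rw [div_le_one (by positivity)]
    linarith [(Nat.cast_nonneg n : (0 : ℝ) ≤ n)]

/-- The mollifications of an `L^p` function converge to it in `L^p`. -/
theorem tendsto_eLpNorm_sub_mollify [CompleteSpace F] {p : ℝ≥0∞} (hp : 1 ≤ p) (hp' : p ≠ ⊤)
    {f : E → F} (hf : MemLp f p μ) :
    Tendsto (fun n => eLpNorm (f - mollify μ n f) p μ) atTop (𝓝 0) := by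
  rw [ENNReal.tendsto_atTop_zero]
  intro ε hε
  have hε3 : ε / 3 ≠ 0 := by simpa using hε.ne'
  obtain ⟨g, hgc, hfg, hg, hgp⟩ := hf.exists_hasCompactSupport_eLpNorm_sub_le hp' hε3
  obtain ⟨n₀, hn₀⟩ := ENNReal.tendsto_atTop_zero.1
    (tendsto_eLpNorm_sub_mollify_of_continuous (μ := μ) hg hgc hp') (ε / 3)
    (pos_iff_ne_zero.2 hε3)
  refine ⟨n₀, fun n hn => ?_⟩
  have hfl := hf.locallyIntegrable hp
  have hgl := hgp.locallyIntegrable hp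
  -- Density argument: the mollification of f - g is controlled uniformly in n by Young's
  -- inequality, so only the continuous g needs n large.
  have hd : f - mollify μ n f = (f - g) - mollify μ n (f - g) + (g - mollify μ n g) := by
    rw [mollify_sub n hfl hgl]; abel
  have hm1 : AEStronglyMeasurable (f - g) μ := hf.1.sub hgp.1
  have hm2 : AEStronglyMeasurable (mollify μ n (f - g)) μ :=
    (contDiff_mollify n (hfl.sub hgl)).continuous.aestronglyMeasurable
  have hm3 : AEStronglyMeasurable (g - mollify μ n g) μ :=
    hgp.1.sub (contDiff_mollify n hgl).continuous.aestronglyMeasurable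
  calc eLpNorm (f - mollify μ n f) p μ
      ≤ eLpNorm (f - g) p μ + eLpNorm (mollify μ n (f - g)) p μ
        + eLpNorm (g - mollify μ n g) p μ := by
        rw [hd]
        exact (eLpNorm_add_le (hm1.sub hm2) hm3 hp).trans
          (add_le_add_left (eLpNorm_sub_le hm1 hm2 hp) _)
    _ ≤ ε / 3 + ε / 3 + ε / 3 :=
        add_le_add (add_le_add hfg ((eLpNorm_mollify_le n hm1 hp hp').trans hfg)) (hn₀ n hn)
    _ = ε := ENNReal.add_thirds ε

end Mollification

/-! ### Weak gradients of mollifications -/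

section WeakGradient

variable {N : ℕ}

theorem gradient_apply_eq_fderiv (f : EuclideanSpace ℝ (Fin N) → ℝ) (x : EuclideanSpace ℝ (Fin N))
    (i : Fin N) : ∇ f x i = fderiv ℝ f x (EuclideanSpace.single i 1) := by
  have := InnerProductSpace.toDual_symm_apply (𝕜 := ℝ) (x := EuclideanSpace.single i (1 : ℝ))
    (y := fderiv ℝ f x)
  rw [← this, EuclideanSpace.inner_single_right]
  simp [gradient]

theorem norm_gradient_eq (f : EuclideanSpace ℝ (Fin N) → ℝ) (x : EuclideanSpace ℝ (Fin N)) :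
    ‖∇ f x‖ = ‖fderiv ℝ f x‖ := by
  simp [gradient]

theorem EuclideanSpace.integral_coord {α : Type*} [MeasurableSpace α] {μ : Measure α}
    {f : α → EuclideanSpace ℝ (Fin N)} (hf : Integrable f μ) (i : Fin N) :
    (∫ x, f x ∂μ) i = ∫ x, f x i ∂μ :=
  ((EuclideanSpace.proj i : EuclideanSpace ℝ (Fin N) →L[ℝ] ℝ).integral_comp_comm hf).symm

/-- The derivative can be put on the kernel, and y ↦ ρ(x - y) is itself a test function on the whole
space. The sign from reflecting the kernel cancels the one from integrating by parts. -/
theorem HasWeakGradient.gradient_mollify {w : EuclideanSpace ℝ (Fin N) → ℝ}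
    {G : EuclideanSpace ℝ (Fin N) → EuclideanSpace ℝ (Fin N)} (h : HasWeakGradient univ w G)
    (n : ℕ) : ∇ (mollify volume n w) = mollify volume n G := by
  have hw : LocallyIntegrable w volume := locallyIntegrableOn_univ.1 h.locallyIntegrable
  have hG : LocallyIntegrable G volume := locallyIntegrableOn_univ.1 h.locallyIntegrable_grad
  set ρ : EuclideanSpace ℝ (Fin N) → ℝ := (shrinkingBump _ n).normed volume with hρ
  have hρc : ContDiff ℝ ∞ ρ := (shrinkingBump _ n).contDiff_normed
  have hρs : HasCompactSupport ρ := (shrinkingBump _ n).hasCompactSupport_normed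
  ext x i
  have hψ : IsCcSmooth univ fun y => ρ (x - y) :=
    ⟨hρc.comp (contDiff_const.sub contDiff_id),
      hρs.comp_homeomorph (Homeomorph.subLeft x), subset_univ _⟩
  have hfd : ∀ y v, fderiv ℝ (fun y => ρ (x - y)) y v = - fderiv ℝ ρ (x - y) v := by
    intro y v
    have h1 : HasFDerivAt (fun y => ρ (x - y)) ((fderiv ℝ ρ (x - y)).comp
        (-ContinuousLinearMap.id ℝ _)) y :=
      (hρc.differentiable (by simp) _).hasFDerivAt.comp y ((hasFDerivAt_id y).const_sub x)
    rw [h1.fderiv]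
    simp
  have key := h.integral_eq _ hψ i
  rw [Measure.restrict_univ] at key
  have hce1 : ConvolutionExists (fderiv ℝ ρ) w ((ContinuousLinearMap.lsmul ℝ ℝ).precompL _) volume :=
    HasCompactSupport.convolutionExists_left _ (hρs.fderiv ℝ) (hρc.continuous_fderiv (by simp)) hw
  have hce2 : ConvolutionExists ρ G (ContinuousLinearMap.lsmul ℝ ℝ) volume :=
    HasCompactSupport.convolutionExists_left _ hρs hρc.continuous hG
  rw [gradient_apply_eq_fderiv, mollify, mollify,
    (hρs.hasFDerivAt_convolution_left _ (hρc.of_le (by simp)) hw x).fderiv,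
    convolution_eq_swap, convolution_eq_swap,
    EuclideanSpace.integral_coord (hce2 x).integrable_swap,
    ContinuousLinearMap.integral_apply (hce1 x).integrable_swap]
  simp only [hfd] at key
  rw [← neg_inj]
  convert key using 1
  · rw [← integral_neg]
    congr 1; ext y
    simp [ContinuousLinearMap.precompL_apply, mul_comm]
  · congr 2; ext y
    simp [mul_comm]

end WeakGradient

/-! ### Cut-off functions and extension to the whole space -/

section Cutoff

/-- Equality to 1 in a neighbourhood of each point of `K`, not only on `K`, makes the derivative of
the cut-off vanish there too; two nested compact sets leave the room for this. -/
theorem exists_contDiff_cutoff {E : Type*} [NormedAddCommGroup E] [NormedSpace ℝ E]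
    [FiniteDimensional ℝ E] {K U : Set E} (hK : IsCompact K) (hU : IsOpen U) (hKU : K ⊆ U) :
    ∃ χ : E → ℝ, ContDiff ℝ ∞ χ ∧ HasCompactSupport χ ∧ tsupport χ ⊆ U ∧
      ∀ x ∈ K, ∀ᶠ y in 𝓝 x, χ y = 1 := by
  obtain ⟨K₁, hK₁, hKK₁, hK₁U⟩ := exists_compact_between hK hU hKU
  obtain ⟨K₂, hK₂, hK₁₂, hK₂U⟩ := exists_compact_between hK₁ hU hK₁U
  obtain ⟨χ, hχ, -, hsupp, hone⟩ := exists_contMDiff_support_eq_eq_one_iff (n := (⊤ : ℕ∞))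
    (modelWithCornersSelf ℝ E) isOpen_interior hK₁.isClosed hK₁₂
  have hts : tsupport χ ⊆ K₂ := closure_minimal (hsupp ▸ interior_subset) hK₂.isClosed
  refine ⟨χ, hχ.contDiff, hK₂.of_isClosed_subset (isClosed_tsupport χ) hts, hts.trans hK₂U,
    fun x hx => ?_⟩
  filter_upwards [isOpen_interior.mem_nhds (hKK₁ hx)] with y hy
  exact (hone y).1 (interior_subset hy)

theorem IsCcSmooth.exists_eq_one {N : ℕ} {K Ω : Set (EuclideanSpace ℝ (Fin N))}
    (hK : IsCompact K) (hΩ : IsOpen Ω) (hKΩ : K ⊆ Ω) :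
    ∃ χ, IsCcSmooth Ω χ ∧ ∀ x ∈ K, ∀ᶠ y in 𝓝 x, χ y = 1 := by
  obtain ⟨χ, h1, h2, h3, h4⟩ := exists_contDiff_cutoff hK hΩ hKΩ
  exact ⟨χ, ⟨h1, h2, h3⟩, h4⟩

theorem MeasureTheory.LocallyIntegrableOn.integrable_smul_of_tsupport_subset {X E : Type*}
    [TopologicalSpace X] [MeasurableSpace X] [OpensMeasurableSpace X] [T2Space X]
    [TopologicalSpace.PseudoMetrizableSpace X]
    [NormedAddCommGroup E] [NormedSpace ℝ E] {μ : Measure X} {f : X → E} {U : Set X}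
    (hf : LocallyIntegrableOn f U μ) {χ : X → ℝ} (hχ : Continuous χ) (hχs : HasCompactSupport χ)
    (hχU : tsupport χ ⊆ U) : Integrable (fun x => χ x • f x) μ := by
  have h1 : IntegrableOn (fun x => χ x • f x) (tsupport χ) μ :=
    (hf.integrableOn_compact_subset hχU hχs).continuousOn_smul hχ.continuousOn hχs
  refine (integrableOn_iff_integrable_of_support_subset fun x hx => ?_).1 h1
  by_contra h
  exact hx (by simp [image_eq_zero_of_notMem_tsupport h])

variable {N : ℕ} {Ω : Set (EuclideanSpace ℝ (Fin N))}

theorem IsCcSmooth.eq_zero_of_notMem {ψ : EuclideanSpace ℝ (Fin N) → ℝ} (hψ : IsCcSmooth Ω ψ)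
    {x : EuclideanSpace ℝ (Fin N)} (hx : x ∉ Ω) : ψ x = 0 :=
  image_eq_zero_of_notMem_tsupport fun h => hx (hψ.support_subset h)

theorem IsCcSmooth.fderiv_eq_zero_of_notMem {ψ : EuclideanSpace ℝ (Fin N) → ℝ}
    (hψ : IsCcSmooth Ω ψ) {x : EuclideanSpace ℝ (Fin N)} (hx : x ∉ Ω) : fderiv ℝ ψ x = 0 :=
  image_eq_zero_of_notMem_tsupport fun h => hx (hψ.support_subset (tsupport_fderiv_subset ℝ h))

theorem IsCcSmooth.mul {χ ψ : EuclideanSpace ℝ (Fin N) → ℝ} (hχ : IsCcSmooth Ω χ)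
    (hψ : ContDiff ℝ ∞ ψ) : IsCcSmooth Ω fun x => χ x * ψ x :=
  ⟨hχ.smooth.mul hψ, hχ.compactSupport.mul_right,
    (closure_mono (Function.support_mul_subset_left _ _)).trans hχ.support_subset⟩

theorem IsCcSmooth.fderiv_apply_continuous {ψ : EuclideanSpace ℝ (Fin N) → ℝ}
    (hψ : IsCcSmooth Ω ψ) (v : EuclideanSpace ℝ (Fin N)) : Continuous fun x => fderiv ℝ ψ x v :=
  (hψ.smooth.continuous_fderiv (by simp)).clm_apply continuous_const

theorem IsCcSmooth.tsupport_fderiv_apply_subset {ψ : EuclideanSpace ℝ (Fin N) → ℝ}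
    (v : EuclideanSpace ℝ (Fin N)) : (tsupport fun x => fderiv ℝ ψ x v) ⊆ tsupport ψ :=
  (closure_mono fun x hx => by
    rw [Function.mem_support] at hx ⊢
    exact fun h => hx (by rw [h]; rfl)).trans (tsupport_fderiv_subset ℝ)

theorem MeasureTheory.LocallyIntegrableOn.euclidean_coord
    {f : EuclideanSpace ℝ (Fin N) → EuclideanSpace ℝ (Fin N)}
    (hf : LocallyIntegrableOn f Ω volume) (i : Fin N) :
    LocallyIntegrableOn (fun x => f x i) Ω volume := fun x hx => by
  obtain ⟨s, hs, h⟩ := hf x hx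
  exact ⟨s, hs, (EuclideanSpace.proj i : EuclideanSpace ℝ (Fin N) →L[ℝ] ℝ).integrable_comp h⟩

/-- A cut-off function extends a weakly differentiable function on `Ω` to the whole space. -/
theorem HasWeakGradient.cutoff_mul {w : EuclideanSpace ℝ (Fin N) → ℝ}
    {Dw : EuclideanSpace ℝ (Fin N) → EuclideanSpace ℝ (Fin N)} (hw : HasWeakGradient Ω w Dw)
    {χ : EuclideanSpace ℝ (Fin N) → ℝ} (hχ : IsCcSmooth Ω χ) :
    HasWeakGradient univ (fun x => χ x * w x) (fun x => χ x • Dw x + w x • ∇ χ x) := by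
  have hgc : Continuous (∇ χ) :=
    (InnerProductSpace.toDual ℝ _).symm.continuous.comp (hχ.smooth.continuous_fderiv (by simp))
  have hgs : tsupport (∇ χ) ⊆ tsupport χ := by
    refine (closure_mono fun x hx => ?_).trans (tsupport_fderiv_subset ℝ)
    rw [Function.mem_support] at hx ⊢
    contrapose! hx
    simp [gradient, hx]
  have hint1 : Integrable (fun x => χ x * w x) volume :=
    hw.locallyIntegrable.integrable_smul_of_tsupport_subset hχ.smooth.continuous
      hχ.compactSupport hχ.support_subset
  have hint2 : Integrable (fun x => χ x • Dw x) volume :=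
    hw.locallyIntegrable_grad.integrable_smul_of_tsupport_subset hχ.smooth.continuous
      hχ.compactSupport hχ.support_subset
  have hint3 : Integrable (fun x => w x • ∇ χ x) volume := by
    have h1 : IntegrableOn (fun x => w x • ∇ χ x) (tsupport χ) volume :=
      (hw.locallyIntegrable.integrableOn_compact_subset hχ.support_subset
        hχ.compactSupport).smul_continuousOn hgc.continuousOn hχ.compactSupport
    refine (integrableOn_iff_integrable_of_support_subset fun x hx => ?_).1 h1
    by_contra h
    exact hx (by simp [image_eq_zero_of_notMem_tsupport fun h' => h (hgs h')])
  refine ⟨hint1.locallyIntegrable.locallyIntegrableOn _,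
    (hint2.add hint3).locallyIntegrable.locallyIntegrableOn _, fun ψ hψ i => ?_⟩
  have hχψ := hχ.mul hψ.smooth
  have key := hw.integral_eq _ hχψ i
  have hfd : ∀ x, fderiv ℝ (fun x => χ x * ψ x) x (EuclideanSpace.single i 1)
      = χ x * fderiv ℝ ψ x (EuclideanSpace.single i 1)
        + ψ x * fderiv ℝ χ x (EuclideanSpace.single i 1) := by
    intro x
    have h1 := (hχ.smooth.differentiable (by simp) x).hasFDerivAt.mul
      (hψ.smooth.differentiable (by simp) x).hasFDerivAt
    have h2 : fderiv ℝ (fun x => χ x * ψ x) x = _ := h1.fderiv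
    rw [h2]
    simp
  rw [setIntegral_eq_integral_of_forall_compl_eq_zero fun x hx => by
      rw [hχψ.fderiv_eq_zero_of_notMem hx]; simp,
    setIntegral_eq_integral_of_forall_compl_eq_zero fun x hx => by
      rw [hχψ.eq_zero_of_notMem hx]; simp] at key
  rw [Measure.restrict_univ]
  have hi1 : Integrable (fun x => (χ x * w x) * fderiv ℝ ψ x (EuclideanSpace.single i 1)) volume := by
    have := (hw.locallyIntegrable).integrable_smul_of_tsupport_subset
      (χ := fun x => χ x * fderiv ℝ ψ x (EuclideanSpace.single i 1))
      (hχ.smooth.continuous.mul (hψ.fderiv_apply_continuous _)) hχ.compactSupport.mul_right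
      ((closure_mono (Function.support_mul_subset_left _ _)).trans hχ.support_subset)
    refine this.congr (ae_of_all _ fun x => ?_)
    simp only [smul_eq_mul]; ring
  have hi2 : Integrable (fun x => w x * (ψ x * fderiv ℝ χ x (EuclideanSpace.single i 1))) volume := by
    have := (hw.locallyIntegrable).integrable_smul_of_tsupport_subset
      (χ := fun x => ψ x * fderiv ℝ χ x (EuclideanSpace.single i 1))
      (hψ.smooth.continuous.mul (hχ.fderiv_apply_continuous _)) hψ.compactSupport.mul_right
      ((closure_mono (Function.support_mul_subset_right _ _)).trans
        ((IsCcSmooth.tsupport_fderiv_apply_subset _).trans hχ.support_subset))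
    refine this.congr (ae_of_all _ fun x => ?_)
    simp only [smul_eq_mul]; ring
  have hi3 : Integrable (fun x => Dw x i * (χ x * ψ x)) volume := by
    have := (hw.locallyIntegrable_grad.euclidean_coord i).integrable_smul_of_tsupport_subset
      hχψ.smooth.continuous hχψ.compactSupport hχψ.support_subset
    refine this.congr (ae_of_all _ fun x => ?_)
    simp only [smul_eq_mul]; ring
  have e1 : ∫ x, w x * fderiv ℝ (fun x => χ x * ψ x) x (EuclideanSpace.single i 1)
      = (∫ x, (χ x * w x) * fderiv ℝ ψ x (EuclideanSpace.single i 1))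
        + ∫ x, w x * (ψ x * fderiv ℝ χ x (EuclideanSpace.single i 1)) := by
    rw [← integral_add hi1 hi2]
    congr 1; ext x
    rw [hfd]; ring
  have e2 : ∫ x, (χ x • Dw x + w x • ∇ χ x) i * ψ x
      = (∫ x, Dw x i * (χ x * ψ x))
        + ∫ x, w x * (ψ x * fderiv ℝ χ x (EuclideanSpace.single i 1)) := by
    rw [← integral_add hi3 hi2]
    congr 1; ext x
    rw [← gradient_apply_eq_fderiv]
    simp only [PiLp.add_apply, PiLp.smul_apply, smul_eq_mul]; ring
  rw [e2]
  linarith [e1, key]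

end Cutoff

/-! ### Smooth approximation and the chain rule for compactly supported outer functions -/

section ChainRule

/-- Write a_n f_n = a_n f' - a_n (f' - f_n): dominated convergence handles the first term, and the
uniform bound on a_n with L¹ convergence the second. -/
theorem tendsto_integral_mul_of_tendsto_eLpNorm_one {α : Type*} [MeasurableSpace α] {μ : Measure α}
    {a : ℕ → α → ℝ} {a' : α → ℝ} {f : ℕ → α → ℝ} {f' : α → ℝ} {C : ℝ}
    (ha : ∀ n, AEStronglyMeasurable (a n) μ) (hC : ∀ n x, |a n x| ≤ C)
    (hlim : ∀ x, Tendsto (fun n => a n x) atTop (𝓝 (a' x)))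
    (hf : ∀ n, Integrable (f n) μ) (hf' : Integrable f' μ)
    (hff : Tendsto (fun n => eLpNorm (f' - f n) 1 μ) atTop (𝓝 0)) :
    Tendsto (fun n => ∫ x, a n x * f n x ∂μ) atTop (𝓝 (∫ x, a' x * f' x ∂μ)) := by
  have h1 : Tendsto (fun n => ∫ x, a n x * f' x ∂μ) atTop (𝓝 (∫ x, a' x * f' x ∂μ)) := by
    refine tendsto_integral_of_dominated_convergence (fun x => C * |f' x|)
      (fun n => (ha n).mul hf'.1) (hf'.abs.const_mul C) (fun n => ae_of_all _ fun x => ?_)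
      (ae_of_all _ fun x => (hlim x).mul_const _)
    rw [norm_mul]
    exact mul_le_mul_of_nonneg_right (hC n x) (abs_nonneg _)
  have hd : Tendsto (fun n => C * (eLpNorm (f' - f n) 1 μ).toReal) atTop (𝓝 0) := by
    have := ((ENNReal.tendsto_toReal ENNReal.zero_ne_top).comp hff).const_mul C
    simpa using this
  have h2 : Tendsto (fun n => ∫ x, a n x * (f' - f n) x ∂μ) atTop (𝓝 0) := by
    refine squeeze_zero_norm (fun n => ?_) hd
    have hi := (hf'.sub (hf n))
    rw [eLpNorm_one_eq_lintegral_enorm, ← integral_norm_eq_lintegral_enorm hi.1,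
      ← integral_const_mul]
    refine norm_integral_le_of_norm_le (hi.norm.const_mul C) (ae_of_all _ fun x => ?_)
    rw [norm_mul]
    exact mul_le_mul_of_nonneg_right (hC n x) (norm_nonneg _)
  have h3 := h1.sub h2
  rw [sub_zero] at h3
  refine h3.congr fun n => ?_
  have hi : ∀ {g : α → ℝ}, Integrable g μ → Integrable (fun x => a n x * g x) μ := fun hg =>
    hg.bdd_mul (ha n) (ae_of_all _ (hC n))
  rw [← integral_sub (hi hf') (hi (hf'.sub (hf n)))]
  congr 1; ext x
  simp only [Pi.sub_apply]; ring

variable {N : ℕ} {Ω : Set (EuclideanSpace ℝ (Fin N))}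
  {u v : EuclideanSpace ℝ (Fin N) → ℝ}
  {Du Dv : EuclideanSpace ℝ (Fin N) → EuclideanSpace ℝ (Fin N)}

theorem continuous_mul_of_tsupport_subset {X : Type*} [TopologicalSpace X] {U : Set X}
    (hU : IsOpen U) {χ w : X → ℝ} (hχ : Continuous χ) (hχU : tsupport χ ⊆ U)
    (hw : ContinuousOn w U) : Continuous fun x => χ x * w x := by
  rw [continuous_iff_continuousAt]
  intro x
  by_cases hx : x ∈ tsupport χ
  · exact hχ.continuousAt.mul (hw.continuousAt (hU.mem_nhds (hχU hx)))
  · have h0 : (fun x => χ x * w x) =ᶠ[𝓝 x] fun _ => 0 := by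
      filter_upwards [notMem_tsupport_iff_eventuallyEq.1 hx] with y hy
      simp [hy]
    exact continuousAt_const.congr h0.symm

/-- Local approximation of weakly differentiable continuous functions by smooth functions. -/
theorem HasWeakGradient.exists_smooth_approx (hΩ : IsOpen Ω) (hu : HasWeakGradient Ω u Du)
    (huc : ContinuousOn u Ω) {K : Set (EuclideanSpace ℝ (Fin N))} (hK : IsCompact K)
    (hKΩ : K ⊆ Ω) :
    ∃ (U : ℕ → EuclideanSpace ℝ (Fin N) → ℝ)
      (G : EuclideanSpace ℝ (Fin N) → EuclideanSpace ℝ (Fin N)),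
      (∀ n, ContDiff ℝ ∞ (U n)) ∧ (∀ n, Integrable (∇ (U n)) volume) ∧ Integrable G volume ∧
      (∀ x ∈ K, Tendsto (fun n => U n x) atTop (𝓝 (u x))) ∧ (∀ x ∈ K, G x = Du x) ∧
      Tendsto (fun n => eLpNorm (G - ∇ (U n)) 1 volume) atTop (𝓝 0) := by
  obtain ⟨χ, hχ, hχK⟩ := IsCcSmooth.exists_eq_one hK hΩ hKΩ
  have hG := hu.cutoff_mul hχ
  set G : EuclideanSpace ℝ (Fin N) → EuclideanSpace ℝ (Fin N) :=
    fun x => χ x • Du x + u x • ∇ χ x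
  have hcont : Continuous fun x => χ x * u x :=
    continuous_mul_of_tsupport_subset hΩ hχ.smooth.continuous hχ.support_subset huc
  have hGz : ∀ x, x ∉ tsupport χ → G x = 0 := fun x hx => by
    have h2 : fderiv ℝ χ x = 0 :=
      image_eq_zero_of_notMem_tsupport fun h => hx (tsupport_fderiv_subset ℝ h)
    simp [G, image_eq_zero_of_notMem_tsupport hx, gradient, h2]
  have hGi : Integrable G volume := by
    refine (integrableOn_iff_integrable_of_support_subset fun x hx => ?_).1
      (hG.locallyIntegrable_grad.integrableOn_compact_subset (subset_univ _) hχ.compactSupport)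
    by_contra h
    exact hx (hGz x h)
  have hsupp : HasCompactSupport fun x => χ x * u x := hχ.compactSupport.mul_right
  have hGs : HasCompactSupport G := HasCompactSupport.intro hχ.compactSupport hGz
  refine ⟨fun n => mollify volume n fun x => χ x * u x, G,
    fun n => contDiff_mollify n hcont.locallyIntegrable, fun n => ?_, hGi, fun x hx => ?_,
    fun x hx => ?_, ?_⟩
  · rw [hG.gradient_mollify]
    exact (contDiff_mollify n hGi.locallyIntegrable).continuous.integrable_of_hasCompactSupport
      (hasCompactSupport_mollify n hGs)
  · have := (tendstoUniformly_mollify (μ := volume) hcont hsupp).tendsto_at x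
    simpa [(hχK x hx).self_of_nhds] using this
  · have h0 : fderiv ℝ χ x = 0 := by
      have : χ =ᶠ[𝓝 x] fun _ => 1 := hχK x hx
      rw [this.fderiv_eq]; simp
    simp [G, (hχK x hx).self_of_nhds, gradient, h0]
  · simp only [hG.gradient_mollify]
    exact tendsto_eLpNorm_sub_mollify le_rfl ENNReal.one_ne_top (memLp_one_iff_integrable.2 hGi)

/-- `w` is continuous on `Ω` and belongs to `W^{1,p}_loc(Ω)`. -/
structure IsContSobolev (Ω : Set (EuclideanSpace ℝ (Fin N))) (p : ℝ≥0∞)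
    (w : EuclideanSpace ℝ (Fin N) → ℝ)
    (Dw : EuclideanSpace ℝ (Fin N) → EuclideanSpace ℝ (Fin N)) : Prop where
  continuousOn : ContinuousOn w Ω
  hasWeakGradient : HasWeakGradient Ω w Dw
  memLpLoc_grad : MemLpLoc Ω p Dw

/-- The identity is classical for smooth approximants, whose values converge pointwise and whose
gradients converge in L¹ to the right limits on the support of ψ. Compact support of Φ bounds Φ and
its derivative globally, which allows passage to the limit. -/
theorem integral_comp₂_of_hasCompactSupport (hΩ : IsOpen Ω)
    (hu : HasWeakGradient Ω u Du) (hv : HasWeakGradient Ω v Dv)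
    (huc : ContinuousOn u Ω) (hvc : ContinuousOn v Ω) {Φ : ℝ × ℝ → ℝ} (hΦ : ContDiff ℝ 1 Φ)
    (hΦs : HasCompactSupport Φ) {ψ : EuclideanSpace ℝ (Fin N) → ℝ} (hψ : IsCcSmooth Ω ψ)
    (i : Fin N) :
    ∫ x, Φ (u x, v x) * fderiv ℝ ψ x (EuclideanSpace.single i 1)
      = -∫ x, (fderiv ℝ Φ (u x, v x) (1, 0) * Du x i + fderiv ℝ Φ (u x, v x) (0, 1) * Dv x i)
          * ψ x := by
  set S := tsupport ψ with hS
  obtain ⟨U, G, hU, hUi, hGi, hUu, hGu, hUG⟩ :=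
    hu.exists_smooth_approx hΩ huc hψ.compactSupport hψ.support_subset
  obtain ⟨V, H, hV, hVi, hHi, hVv, hHv, hVH⟩ :=
    hv.exists_smooth_approx hΩ hvc hψ.compactSupport hψ.support_subset
  have hψ0 : ∀ x, x ∉ S → ψ x = 0 := fun x hx => image_eq_zero_of_notMem_tsupport hx
  have hψ0' : ∀ x, x ∉ S → fderiv ℝ ψ x = 0 := fun x hx =>
    image_eq_zero_of_notMem_tsupport fun h => hx (tsupport_fderiv_subset ℝ h)
  have hΦ' : Continuous (fderiv ℝ Φ) := hΦ.continuous_fderiv (by simp)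
  have hUV : ∀ n, ContDiff ℝ 1 fun x => (U n x, V n x) := fun n =>
    ((hU n).of_le (by simp)).prodMk ((hV n).of_le (by simp))
  have hΦn : ∀ n, ContDiff ℝ 1 fun x => Φ (U n x, V n x) := fun n => hΦ.comp (hUV n)
  have hfd : ∀ n x, fderiv ℝ (fun x => Φ (U n x, V n x)) x (EuclideanSpace.single i 1)
      = fderiv ℝ Φ (U n x, V n x) (1, 0) * ∇ (U n) x i
        + fderiv ℝ Φ (U n x, V n x) (0, 1) * ∇ (V n) x i := by
    intro n x
    have h1 : HasFDerivAt (fun x => Φ (U n x, V n x)) _ x :=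
      ((hΦ.differentiable (by simp)) (U n x, V n x)).hasFDerivAt.comp x
        (((hU n).differentiable (by simp) x).hasFDerivAt.prodMk
          ((hV n).differentiable (by simp) x).hasFDerivAt)
    rw [h1.fderiv, gradient_apply_eq_fderiv, gradient_apply_eq_fderiv]
    set a := fderiv ℝ (U n) x (EuclideanSpace.single i 1)
    set b := fderiv ℝ (V n) x (EuclideanSpace.single i 1)
    have h2 : ((a, b) : ℝ × ℝ) = a • ((1, 0) : ℝ × ℝ) + b • ((0, 1) : ℝ × ℝ) := by simp
    change fderiv ℝ Φ (U n x, V n x) (a, b) = _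
    rw [h2, map_add, map_smul, map_smul, smul_eq_mul, smul_eq_mul, mul_comm a, mul_comm b]
  have hψi : Continuous fun x => fderiv ℝ ψ x (EuclideanSpace.single i 1) :=
    hψ.fderiv_apply_continuous _
  have hψis : HasCompactSupport fun x => fderiv ℝ ψ x (EuclideanSpace.single i 1) :=
    hψ.compactSupport.of_isClosed_subset (isClosed_tsupport _)
      (IsCcSmooth.tsupport_fderiv_apply_subset _)
  have hparts : ∀ n, ∫ x, Φ (U n x, V n x) * fderiv ℝ ψ x (EuclideanSpace.single i 1)
      = -((∫ x, (fderiv ℝ Φ (U n x, V n x) (1, 0) * ψ x) * ∇ (U n) x i)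
        + ∫ x, (fderiv ℝ Φ (U n x, V n x) (0, 1) * ψ x) * ∇ (V n) x i) := by
    intro n
    have hcd : Continuous fun x =>
        fderiv ℝ (fun x => Φ (U n x, V n x)) x (EuclideanSpace.single i 1) :=
      ((hΦn n).continuous_fderiv (by simp)).clm_apply continuous_const
    rw [integral_mul_fderiv_eq_neg_fderiv_mul_of_integrable
      ((hcd.mul hψ.smooth.continuous).integrable_of_hasCompactSupport hψ.compactSupport.mul_left)
      (((hΦn n).continuous.mul hψi).integrable_of_hasCompactSupport hψis.mul_left)
      (((hΦn n).continuous.mul hψ.smooth.continuous).integrable_of_hasCompactSupport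
        hψ.compactSupport.mul_left)
      (fun x _ => (hΦn n).differentiable (by simp) x)
      (fun x _ => hψ.smooth.differentiable (by simp) x)]
    have hint : ∀ (w : EuclideanSpace ℝ (Fin N) → ℝ) (e : ℝ × ℝ), ContDiff ℝ ∞ w → Integrable
        (fun x => (fderiv ℝ Φ (U n x, V n x) e * ψ x) * ∇ w x i) volume := by
      intro w e hw
      simp only [gradient_apply_eq_fderiv]
      exact (((hΦ'.comp (hUV n).continuous).clm_apply continuous_const).mul
        hψ.smooth.continuous |>.mul ((hw.continuous_fderiv (by simp)).clm_apply
          continuous_const)).integrable_of_hasCompactSupport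
            (hψ.compactSupport.mul_left.mul_right)
    rw [← integral_add (hint _ _ (hU n)) (hint _ _ (hV n))]
    congr 2; ext x
    rw [hfd]; ring
  obtain ⟨C₀, hC₀⟩ := hΦs.exists_bound_of_continuous hΦ.continuous
  obtain ⟨C₁, hC₁⟩ := (hΦs.fderiv ℝ).exists_bound_of_continuous hΦ'
  obtain ⟨C₂, hC₂⟩ := hψ.compactSupport.exists_bound_of_continuous hψ.smooth.continuous
  have hUVlim : ∀ x ∈ S, Tendsto (fun n => (U n x, V n x)) atTop (𝓝 (u x, v x)) :=
    fun x hx => (hUu x hx).prodMk_nhds (hVv x hx)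
  have hlim1 : Tendsto (fun n => ∫ x, Φ (U n x, V n x) * fderiv ℝ ψ x (EuclideanSpace.single i 1))
      atTop (𝓝 (∫ x, Φ (u x, v x) * fderiv ℝ ψ x (EuclideanSpace.single i 1))) := by
    refine tendsto_integral_of_dominated_convergence
      (fun x => C₀ * ‖fderiv ℝ ψ x (EuclideanSpace.single i 1)‖)
      (fun n => ((hΦn n).continuous.mul hψi).aestronglyMeasurable)
      ((hψi.integrable_of_hasCompactSupport hψis).norm.const_mul _)
      (fun n => ae_of_all _ fun x => ?_) (ae_of_all _ fun x => ?_)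
    · rw [norm_mul]
      exact mul_le_mul_of_nonneg_right (hC₀ _) (norm_nonneg _)
    · by_cases hx : x ∈ S
      · exact ((hΦ.continuous.tendsto _).comp (hUVlim x hx)).mul_const _
      · simp [hψ0' x hx]
  have hlim2 : ∀ (e : ℝ × ℝ) (W : ℕ → EuclideanSpace ℝ (Fin N) → ℝ)
      (G Dw : EuclideanSpace ℝ (Fin N) → EuclideanSpace ℝ (Fin N)),
      (∀ n, Integrable (∇ (W n)) volume) → Integrable G volume → (∀ x ∈ S, G x = Dw x) →
      Tendsto (fun n => eLpNorm (G - ∇ (W n)) 1 volume) atTop (𝓝 0) →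
      Integrable (fun x => (fderiv ℝ Φ (u x, v x) e * ψ x) * Dw x i) volume ∧
      Tendsto (fun n => ∫ x, (fderiv ℝ Φ (U n x, V n x) e * ψ x) * ∇ (W n) x i) atTop
        (𝓝 (∫ x, (fderiv ℝ Φ (u x, v x) e * ψ x) * Dw x i)) := by
    intro e W G Dw hWi hGi hG hWG
    have hpi : ∀ {f : EuclideanSpace ℝ (Fin N) → EuclideanSpace ℝ (Fin N)}, Integrable f volume →
        Integrable (fun x => f x i) volume := fun hf =>
      (EuclideanSpace.proj i : EuclideanSpace ℝ (Fin N) →L[ℝ] ℝ).integrable_comp hf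
    have hcn : ∀ n, Continuous fun x => fderiv ℝ Φ (U n x, V n x) e * ψ x := fun n =>
      ((hΦ'.comp (hUV n).continuous).clm_apply continuous_const).mul hψ.smooth.continuous
    have hbd : ∀ q x, |fderiv ℝ Φ q e * ψ x| ≤ C₁ * ‖e‖ * C₂ := fun q x => by
      rw [abs_mul]
      exact mul_le_mul (((fderiv ℝ Φ q).le_opNorm e).trans
        (mul_le_mul_of_nonneg_right (hC₁ q) (norm_nonneg e))) (hC₂ x) (abs_nonneg _)
        (mul_nonneg ((norm_nonneg _).trans (hC₁ 0)) (norm_nonneg _))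
    have hpt : ∀ x, Tendsto (fun n => fderiv ℝ Φ (U n x, V n x) e * ψ x) atTop
        (𝓝 (fderiv ℝ Φ (u x, v x) e * ψ x)) := fun x => by
      by_cases hx : x ∈ S
      · exact (((hΦ'.clm_apply (continuous_const (y := e))).tendsto (u x, v x)).comp
          (hUVlim x hx)).mul_const _
      · simp [hψ0 x hx]
    have heq : (fun x => (fderiv ℝ Φ (u x, v x) e * ψ x) * Dw x i)
        = fun x => (fderiv ℝ Φ (u x, v x) e * ψ x) * G x i := by
      ext x
      by_cases hx : x ∈ S
      · rw [hG x hx]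
      · simp [hψ0 x hx]
    rw [heq]
    refine ⟨(hpi hGi).bdd_mul (aestronglyMeasurable_of_tendsto_ae atTop
      (fun n => (hcn n).aestronglyMeasurable) (ae_of_all _ hpt))
      (ae_of_all _ fun x => hbd _ x), ?_⟩
    refine tendsto_integral_mul_of_tendsto_eLpNorm_one
      (fun n => (hcn n).aestronglyMeasurable) (fun n x => hbd _ x) hpt (fun n => hpi (hWi n))
      (hpi hGi) ?_
    refine tendsto_of_tendsto_of_tendsto_of_le_of_le tendsto_const_nhds hWG (fun n => zero_le)
      fun n => eLpNorm_mono fun x => ?_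
    simpa using PiLp.norm_apply_le ((G - ∇ (W n)) x) i
  obtain ⟨hi1, hl1⟩ := hlim2 (1, 0) U G Du hUi hGi hGu hUG
  obtain ⟨hi2, hl2⟩ := hlim2 (0, 1) V H Dv hVi hHi hHv hVH
  rw [tendsto_nhds_unique hlim1 ((hl1.add hl2).neg.congr fun n => (hparts n).symm),
    ← integral_add hi1 hi2]
  congr 2; ext x
  ring

end ChainRule

/-! ### The chain rule on open sets and level sets -/

section ChainRuleOn

variable {N : ℕ} {Ω : Set (EuclideanSpace ℝ (Fin N))}
  {u v : EuclideanSpace ℝ (Fin N) → ℝ}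
  {Du Dv : EuclideanSpace ℝ (Fin N) → EuclideanSpace ℝ (Fin N)} {p : ℝ≥0∞}

theorem MemLpLoc.continuousOn_smul {a : EuclideanSpace ℝ (Fin N) → ℝ} (hDu : MemLpLoc Ω p Du)
    (ha : ContinuousOn a Ω) : MemLpLoc Ω p fun x => a x • Du x := fun K hK hKΩ => by
  have haK : ContinuousOn a K := ha.mono hKΩ
  obtain ⟨C, hC⟩ := hK.exists_bound_of_continuousOn haK
  exact (hDu K hK hKΩ).smul (memLp_top_of_bound
    (haK.aestronglyMeasurable hK.measurableSet) C
    ((ae_restrict_iff' hK.measurableSet).2 (ae_of_all _ hC)))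

theorem MemLpLoc.add (hDu : MemLpLoc Ω p Du) (hDv : MemLpLoc Ω p Dv) :
    MemLpLoc Ω p fun x => Du x + Dv x := fun K hK hKΩ => (hDu K hK hKΩ).add (hDv K hK hKΩ)

theorem MemLpLoc.mono_exponent {q : ℝ≥0∞} (hDu : MemLpLoc Ω p Du) (hqp : q ≤ p) :
    MemLpLoc Ω q Du := fun K hK hKΩ => by
  have : IsFiniteMeasure (volume.restrict K) := ⟨by
    rw [Measure.restrict_apply_univ]; exact hK.measure_lt_top⟩
  exact (hDu K hK hKΩ).mono_exponent hqp

theorem IsContSobolev.mono_exponent {q : ℝ≥0∞} (hu : IsContSobolev Ω p u Du) (hqp : q ≤ p) :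
    IsContSobolev Ω q u Du :=
  ⟨hu.continuousOn, hu.hasWeakGradient, hu.memLpLoc_grad.mono_exponent hqp⟩

/-- The chain rule for a `C¹` function of two weakly differentiable functions. -/
theorem IsContSobolev.comp₂ (hΩ : IsOpen Ω) (hu : IsContSobolev Ω p u Du)
    (hv : IsContSobolev Ω p v Dv) {U : Set (ℝ × ℝ)} (hU : IsOpen U)
    (huv : ∀ x ∈ Ω, (u x, v x) ∈ U) {Φ A B : ℝ × ℝ → ℝ} (hA : ContinuousOn A U)
    (hB : ContinuousOn B U) (hΦ : ∀ q ∈ U, HasFDerivAt Φ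
      (A q • ContinuousLinearMap.fst ℝ ℝ ℝ + B q • ContinuousLinearMap.snd ℝ ℝ ℝ) q) :
    IsContSobolev Ω p (fun x => Φ (u x, v x))
      (fun x => A (u x, v x) • Du x + B (u x, v x) • Dv x) := by
  have hpair : ContinuousOn (fun x => (u x, v x)) Ω := hu.continuousOn.prodMk hv.continuousOn
  have hΦc : ContinuousOn Φ U := fun q hq => (hΦ q hq).continuousAt.continuousWithinAt
  have hΦuv : ContinuousOn (fun x => Φ (u x, v x)) Ω := hΦc.comp hpair huv
  have hAuv : ContinuousOn (fun x => A (u x, v x)) Ω := hA.comp hpair huv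
  have hBuv : ContinuousOn (fun x => B (u x, v x)) Ω := hB.comp hpair huv
  have hli : ∀ {a w : EuclideanSpace ℝ (Fin N) → ℝ}
      {Dw : EuclideanSpace ℝ (Fin N) → EuclideanSpace ℝ (Fin N)}, HasWeakGradient Ω w Dw →
      ContinuousOn a Ω → LocallyIntegrableOn (fun x => a x • Dw x) Ω volume := fun hw ha =>
    hw.locallyIntegrable_grad.continuousOn_smul hΩ.isLocallyClosed ha
  refine ⟨hΦuv, ⟨hΦuv.locallyIntegrableOn hΩ.measurableSet,
    (hli hu.hasWeakGradient hAuv).add (hli hv.hasWeakGradient hBuv), fun ψ hψ i => ?_⟩,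
    (hu.memLpLoc_grad.continuousOn_smul hAuv).add (hv.memLpLoc_grad.continuousOn_smul hBuv)⟩
  have hΦ1 : ContDiffOn ℝ 1 Φ U := by
    rw [show (1 : ℕ∞ω) = 0 + 1 from rfl, contDiffOn_succ_iff_fderiv_of_isOpen hU]
    refine ⟨fun q hq => (hΦ q hq).differentiableAt.differentiableWithinAt, by simp, ?_⟩
    rw [contDiffOn_zero]
    exact ((hA.smul continuousOn_const).add (hB.smul continuousOn_const)).congr
      fun q hq => (hΦ q hq).fderiv
  have hSU : (fun x => (u x, v x)) '' tsupport ψ ⊆ U := by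
    rintro _ ⟨x, hx, rfl⟩
    exact huv x (hψ.support_subset hx)
  -- Only the values of (u, v) on the support of ψ matter. They form a compact subset of `U`, so Φ
  -- may be replaced by θΦ, which is C¹ with compact support and agrees with Φ near those values.
  obtain ⟨θ, hθ, hθs, hθU, hθ1⟩ := exists_contDiff_cutoff
    (hψ.compactSupport.isCompact.image_of_continuousOn (hpair.mono hψ.support_subset)) hU hSU
  have hΨ : ContDiff ℝ 1 fun q => θ q * Φ q := by
    rw [contDiff_iff_contDiffAt]
    intro q
    by_cases hq : q ∈ tsupport θ
    · exact (hθ.of_le (by simp)).contDiffAt.mul (hΦ1.contDiffAt (hU.mem_nhds (hθU hq)))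
    · have h0 : (fun q => θ q * Φ q) =ᶠ[𝓝 q] fun _ => 0 := by
        filter_upwards [notMem_tsupport_iff_eventuallyEq.1 hq] with y hy
        simp [hy]
      exact contDiffAt_const.congr_of_eventuallyEq h0
  have key := integral_comp₂_of_hasCompactSupport hΩ hu.hasWeakGradient hv.hasWeakGradient
    hu.continuousOn hv.continuousOn hΨ hθs.mul_right hψ i
  have hψ0' : ∀ x, x ∉ tsupport ψ → fderiv ℝ ψ x = 0 := fun x hx =>
    image_eq_zero_of_notMem_tsupport fun h => hx (tsupport_fderiv_subset ℝ h)
  have heq : ∀ x ∈ tsupport ψ, (fun q => θ q * Φ q) =ᶠ[𝓝 (u x, v x)] Φ := fun x hx => by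
    filter_upwards [hθ1 _ (mem_image_of_mem _ hx)] with q hq
    rw [hq, one_mul]
  rw [setIntegral_eq_integral_of_forall_compl_eq_zero fun x hx => by
      rw [hψ.fderiv_eq_zero_of_notMem hx]; simp,
    setIntegral_eq_integral_of_forall_compl_eq_zero fun x hx => by
      rw [hψ.eq_zero_of_notMem hx]; simp]
  convert key using 1
  · congr 1; ext x
    by_cases hx : x ∈ tsupport ψ
    · rw [(hθ1 _ (mem_image_of_mem _ hx)).self_of_nhds, one_mul]
    · rw [hψ0' x hx]; simp
  · congr 2; ext x
    by_cases hx : x ∈ tsupport ψ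
    · rw [(heq x hx).fderiv_eq, (hΦ _ (huv x (hψ.support_subset hx))).fderiv]
      simp
    · rw [image_eq_zero_of_notMem_tsupport hx]; simp

/-- The chain rule for a `C¹` function of one variable. -/
theorem IsContSobolev.comp (hΩ : IsOpen Ω) (hu : IsContSobolev Ω p u Du) {I : Set ℝ}
    (hI : IsOpen I) (huI : ∀ x ∈ Ω, u x ∈ I) {F F' : ℝ → ℝ} (hF : ∀ s ∈ I, HasDerivAt F (F' s) s)
    (hF' : ContinuousOn F' I) :
    IsContSobolev Ω p (fun x => F (u x)) (fun x => F' (u x) • Du x) := by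
  have := hu.comp₂ hΩ hu (U := Prod.fst ⁻¹' I) (hI.preimage continuous_fst) huI
    (Φ := fun q => F q.1) (A := fun q => F' q.1) (B := fun _ => 0)
    (hF'.comp continuousOn_fst fun q hq => hq) continuousOn_const fun q hq => by
      have h := (hF q.1 hq).hasFDerivAt.comp q hasFDerivAt_fst
      refine h.congr_fderiv ?_
      ext <;> simp
  simpa using this

theorem IsContSobolev.mul (hΩ : IsOpen Ω) (hu : IsContSobolev Ω p u Du)
    (hv : IsContSobolev Ω p v Dv) :
    IsContSobolev Ω p (fun x => u x * v x) (fun x => v x • Du x + u x • Dv x) := by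
  refine hu.comp₂ hΩ hv isOpen_univ (fun x _ => mem_univ _) (Φ := fun q => q.1 * q.2)
    (A := fun q => q.2) (B := fun q => q.1) (by fun_prop) (by fun_prop) fun q _ => ?_
  refine (hasFDerivAt_fst.mul hasFDerivAt_snd).congr_fderiv ?_
  ext <;> simp

theorem IsContSobolev.sub (hΩ : IsOpen Ω) (hu : IsContSobolev Ω p u Du)
    (hv : IsContSobolev Ω p v Dv) :
    IsContSobolev Ω p (fun x => u x - v x) (fun x => Du x - Dv x) := by
  have := hu.comp₂ hΩ hv isOpen_univ (fun x _ => mem_univ _) (Φ := fun q => q.1 - q.2)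
    (A := fun q => 1) (B := fun q => -1) (by fun_prop) (by fun_prop) fun q _ => by
      refine (hasFDerivAt_fst.sub hasFDerivAt_snd).congr_fderiv ?_
      ext <;> simp
  simpa [sub_eq_add_neg] using this

/-- The weak gradient vanishes almost everywhere on level sets. -/
theorem IsContSobolev.ae_eq_zero_of_level (hΩ : IsOpen Ω) (hu : IsContSobolev Ω p u Du) (c : ℝ) :
    ∀ᵐ x ∂volume.restrict Ω, u x = c → Du x = 0 := by
  have hmeas : MeasurableSet {x ∈ Ω | u x = c} := by
    have : {x ∈ Ω | u x = c} = Ω ∩ u ⁻¹' {c} := rfl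
    rw [this]
    obtain ⟨C, hC, hC'⟩ := continuousOn_iff_isClosed.1 hu.continuousOn {c} isClosed_singleton
    rw [inter_comm, hC']
    exact hC.measurableSet.inter hΩ.measurableSet
  set L : Set (EuclideanSpace ℝ (Fin N)) := {x ∈ Ω | u x = c} with hL
  have hcoord : ∀ i : Fin N, ∀ᵐ x, x ∈ Ω → L.indicator (fun x => Du x i) x = 0 := by
    intro i
    have hDui := hu.hasWeakGradient.locallyIntegrable_grad.euclidean_coord i
    refine hΩ.ae_eq_zero_of_integral_contDiff_smul_eq_zero (fun x hx => ?_)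
      fun ψ hψ hψs hψΩ => ?_
    · obtain ⟨s, hs, h⟩ := hDui x hx
      exact ⟨s, hs, h.indicator hmeas⟩
    have hcc : IsCcSmooth Ω ψ := ⟨hψ, hψs, hψΩ⟩
    set D : EuclideanSpace ℝ (Fin N) → ℝ := fun x => fderiv ℝ ψ x (EuclideanSpace.single i 1)
    have hDi : Integrable D volume := (hcc.fderiv_apply_continuous _).integrable_of_hasCompactSupport
      (hψs.of_isClosed_subset (isClosed_tsupport _) (IsCcSmooth.tsupport_fderiv_apply_subset _))
    have hψDu : Integrable (fun x => ψ x * Du x i) (volume.restrict Ω) :=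
      (hDui.integrable_smul_of_tsupport_subset hψ.continuous hψs hψΩ).integrableOn
    -- The functions arctan((n+1)(s-c))/(n+1) tend to 0 uniformly, while their derivatives stay in
    -- [0,1] and tend to the indicator of {s = c}. In the limit, the integral of ψ ∂ᵢu over the
    -- level set is 0 for every test function ψ.
    have happ : ∀ n : ℕ, ∫ x in Ω, (1 / (n + 1 : ℝ)) * Real.arctan ((n + 1) * (u x - c)) * D x
        = -∫ x in Ω, (1 / (1 + ((n + 1) * (u x - c)) ^ 2)) * (ψ x * Du x i) := by
      intro n
      have h1 := (hu.comp hΩ isOpen_univ (fun x _ => mem_univ _)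
        (F := fun s => (1 / (n + 1 : ℝ)) * Real.arctan ((n + 1) * (s - c)))
        (F' := fun s => 1 / (1 + ((n + 1) * (s - c)) ^ 2)) (fun s _ => by
          have h2 : HasDerivAt (fun s : ℝ => (n + 1 : ℝ) * (s - c)) (n + 1) s := by
            simpa using ((hasDerivAt_id s).sub_const c).const_mul (n + 1 : ℝ)
          refine (h2.arctan.const_mul (1 / (n + 1 : ℝ))).congr_deriv ?_
          field_simp) (Continuous.continuousOn (by
            refine continuous_const.div (by fun_prop) fun s => by positivity))
        ).hasWeakGradient.integral_eq ψ hcc i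
      rw [h1]
      congr 2; ext x
      simp only [PiLp.smul_apply, smul_eq_mul]; ring
    have hl1 : Tendsto (fun n : ℕ => ∫ x in Ω,
        (1 / (n + 1 : ℝ)) * Real.arctan ((n + 1) * (u x - c)) * D x) atTop (𝓝 0) := by
      have hb := (tendsto_one_div_add_atTop_nhds_zero_nat (𝕜 := ℝ)).mul_const
        (∫ x in Ω, Real.pi / 2 * |D x|)
      rw [zero_mul] at hb
      refine squeeze_zero_norm (fun n => ?_) hb
      rw [← integral_const_mul]
      refine norm_integral_le_of_norm_le ((hDi.integrableOn.abs.const_mul _).const_mul _)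
        (ae_of_all _ fun x => ?_)
      rw [norm_mul, norm_mul, mul_assoc, Real.norm_of_nonneg (by positivity : 0 ≤ 1 / (n + 1 : ℝ))]
      gcongr
      · rw [Real.norm_eq_abs, abs_le]
        exact ⟨(Real.neg_pi_div_two_lt_arctan _).le, (Real.arctan_lt_pi_div_two _).le⟩
      · exact le_rfl
    have hl2 : Tendsto (fun n : ℕ => ∫ x in Ω,
        (1 / (1 + ((n + 1) * (u x - c)) ^ 2)) * (ψ x * Du x i)) atTop
        (𝓝 (∫ x in Ω, L.indicator 1 x * (ψ x * Du x i))) := by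
      have hum : AEStronglyMeasurable u (volume.restrict Ω) :=
        hu.continuousOn.aestronglyMeasurable hΩ.measurableSet
      refine tendsto_integral_of_dominated_convergence (fun x => |ψ x * Du x i|)
        (fun n => AEStronglyMeasurable.mul ?_ hψDu.1) hψDu.abs
        (fun n => ae_of_all _ fun x => ?_)
        ((ae_restrict_iff' hΩ.measurableSet).2 (ae_of_all _ fun x hx => Tendsto.mul_const _ ?_))
      · have hc : Continuous fun s : ℝ => 1 / (1 + ((n + 1) * (s - c)) ^ 2) :=
          continuous_const.div (by fun_prop) fun s => by positivity
        exact hc.comp_aestronglyMeasurable hum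
      · rw [norm_mul, Real.norm_of_nonneg (by positivity)]
        refine mul_le_of_le_one_left (norm_nonneg _) ?_
        rw [div_le_one (by positivity)]
        linarith [sq_nonneg (((n : ℝ) + 1) * (u x - c))]
      · by_cases hxc : u x = c
        · have : x ∈ L := ⟨hx, hxc⟩
          simp [this, hxc]
        · have : x ∉ L := fun h => hxc h.2
          rw [indicator_of_notMem this]
          have ht : Tendsto (fun n : ℕ => 1 + (((n : ℝ) + 1) * (u x - c)) ^ 2) atTop atTop := by
            have h0 : 0 < (u x - c) ^ 2 := by
              have := sub_ne_zero.2 hxc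
              positivity
            have h3 : Tendsto (fun n : ℕ => (n : ℝ) + 1) atTop atTop :=
              tendsto_atTop_add_const_right _ _ tendsto_natCast_atTop_atTop
            refine tendsto_atTop_add_const_left _ _ ?_
            simp only [mul_pow]
            exact ((tendsto_pow_atTop two_ne_zero).comp h3).atTop_mul_const h0
          simpa using! ht.inv_tendsto_atTop
    have h0 := tendsto_nhds_unique (hl1.congr happ) hl2.neg
    have h00 : ∫ x in Ω, L.indicator 1 x * (ψ x * Du x i) = 0 := by linarith
    rw [setIntegral_eq_integral_of_forall_compl_eq_zero fun x hx => by
      rw [hcc.eq_zero_of_notMem hx]; simp] at h00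
    rw [← h00]
    congr 1; ext x
    by_cases hx : x ∈ L <;> simp [hx]
  rw [ae_restrict_iff' hΩ.measurableSet]
  filter_upwards [ae_all_iff.2 hcoord] with x hx hxΩ hxc
  ext i
  have := hx i hxΩ
  rwa [indicator_of_mem (show x ∈ L from ⟨hxΩ, hxc⟩)] at this

end ChainRuleOn

/-! ### Test functions in H¹₀ and the Sobolev inequality -/

section TestFunctions

variable {N : ℕ} {Ω : Set (EuclideanSpace ℝ (Fin N))}

/-- Multiplying by a cut-off that is 1 near `K` changes nothing in Ω and yields a weakly
differentiable function on the whole space; its mollifications are the required approximants. -/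
theorem IsContSobolev.isAdmissibleTest (hΩ : IsOpen Ω) {φ : EuclideanSpace ℝ (Fin N) → ℝ}
    {Dφ : EuclideanSpace ℝ (Fin N) → EuclideanSpace ℝ (Fin N)} (hφ : IsContSobolev Ω 2 φ Dφ)
    {K : Set (EuclideanSpace ℝ (Fin N))} (hK : IsCompact K) (hKΩ : K ⊆ Ω)
    (hφK : ∀ x ∈ Ω, x ∉ K → φ x = 0) (hDφK : ∀ x ∈ Ω, x ∉ K → Dφ x = 0)
    (hφ0 : ∀ x ∈ Ω, 0 ≤ φ x) : IsAdmissibleTest Ω φ Dφ := by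
  obtain ⟨χ, hχ, hχK⟩ := IsCcSmooth.exists_eq_one hK hΩ hKΩ
  have hG := hφ.hasWeakGradient.cutoff_mul hχ
  set w : EuclideanSpace ℝ (Fin N) → ℝ := fun x => χ x * φ x with hw
  set G : EuclideanSpace ℝ (Fin N) → EuclideanSpace ℝ (Fin N) :=
    fun x => χ x • Dφ x + φ x • ∇ χ x with hGdef
  have hwc : Continuous w :=
    continuous_mul_of_tsupport_subset hΩ hχ.smooth.continuous hχ.support_subset hφ.continuousOn
  have hws : HasCompactSupport w := hχ.compactSupport.mul_right
  have hgχ : ∀ x ∈ K, ∇ χ x = 0 := fun x hx => by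
    have : χ =ᶠ[𝓝 x] fun _ => 1 := hχK x hx
    simp [gradient, this.fderiv_eq]
  have hwφ : ∀ x ∈ Ω, φ x = w x := fun x hx => by
    by_cases hxK : x ∈ K
    · simp [hw, (hχK x hxK).self_of_nhds]
    · simp [hw, hφK x hx hxK]
  have hGφ : ∀ x ∈ Ω, Dφ x = G x := fun x hx => by
    by_cases hxK : x ∈ K
    · simp [hGdef, (hχK x hxK).self_of_nhds, hgχ x hxK]
    · simp [hGdef, hφK x hx hxK, hDφK x hx hxK]
  have hwK : ∀ x, x ∉ K → w x = 0 := fun x hxK => by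
    by_cases hx : x ∈ Ω
    · rw [← hwφ x hx, hφK x hx hxK]
    · simp [hw, hχ.eq_zero_of_notMem hx]
  have hGK : G = K.indicator Dφ := by
    ext1 x
    by_cases hxK : x ∈ K
    · rw [indicator_of_mem hxK, hGφ x (hKΩ hxK)]
    · rw [indicator_of_notMem hxK]
      by_cases hx : x ∈ Ω
      · rw [← hGφ x hx, hDφK x hx hxK]
      · simp [hGdef, hχ.eq_zero_of_notMem hx, gradient, hχ.fderiv_eq_zero_of_notMem hx]
  have hGp : MemLp G 2 volume := by
    rw [hGK, memLp_indicator_iff_restrict hK.measurableSet]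
    exact hφ.memLpLoc_grad K hK hKΩ
  have aeφ : φ =ᵐ[volume.restrict Ω] w :=
    (ae_restrict_iff' hΩ.measurableSet).2 (ae_of_all _ hwφ)
  have aeD : Dφ =ᵐ[volume.restrict Ω] G :=
    (ae_restrict_iff' hΩ.measurableSet).2 (ae_of_all _ hGφ)
  have hmem : ∀ p : ℝ≥0∞, MemLp φ p (volume.restrict Ω) := fun p =>
    ((hwc.memLp_of_hasCompactSupport hws).restrict Ω).ae_eq aeφ.symm
  -- Dropping the first `n₀` mollifications keeps all the supports inside a thickening of `K`
  -- contained in Ω.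
  obtain ⟨δ, hδ, hδΩ⟩ := hK.exists_cthickening_subset_open hΩ hKΩ
  obtain ⟨n₀, hn₀⟩ := eventually_atTop.1
    ((tendsto_order.1 (tendsto_one_div_add_atTop_nhds_zero_nat (𝕜 := ℝ))).2 δ hδ)
  have htw : tsupport w ⊆ K := closure_minimal (fun x hx => by
    by_contra h; exact hx (hwK x h)) hK.isClosed
  refine ⟨⟨hφ.hasWeakGradient, hmem 2, (hGp.restrict Ω).ae_eq aeD.symm,
    fun n => mollify volume (n + n₀) w, fun n => ⟨contDiff_mollify _ hwc.locallyIntegrable,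
      hasCompactSupport_mollify _ hws, (tsupport_mollify_subset _ _).trans ?_⟩, ?_, ?_⟩,
    hmem ⊤, (ae_restrict_iff' hΩ.measurableSet).2 (ae_of_all _ hφ0), K, hK, hKΩ,
    (ae_restrict_iff' hΩ.measurableSet).2 (ae_of_all _ hφK)⟩
  · exact (Metric.cthickening_subset_of_subset _ htw).trans ((Metric.cthickening_mono
      (hn₀ (n + n₀) (by omega)).le _).trans hδΩ)
  · refine tendsto_of_tendsto_of_tendsto_of_le_of_le tendsto_const_nhds
      ((tendsto_add_atTop_iff_nat n₀).2 (tendsto_eLpNorm_sub_mollify_of_continuous (μ := volume)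
        hwc hws ENNReal.ofNat_ne_top (p := 2))) (fun n => zero_le) fun n => ?_
    refine (eLpNorm_congr_ae ?_).trans_le (eLpNorm_restrict_le _ _ _ _)
    filter_upwards [aeφ] with x hx
    rw [hx]; rfl
  · refine tendsto_of_tendsto_of_tendsto_of_le_of_le tendsto_const_nhds
      ((tendsto_add_atTop_iff_nat n₀).2 (tendsto_eLpNorm_sub_mollify
        one_le_two ENNReal.ofNat_ne_top hGp)) (fun n => zero_le) fun n => ?_
    refine (eLpNorm_congr_ae ?_).trans_le (eLpNorm_restrict_le _ _ _ _)
    filter_upwards [aeD] with x hx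
    rw [hx, hG.gradient_mollify]; rfl

/-- The Sobolev inequality in `H¹₀(Ω)`. -/
theorem MemH10.eLpNorm_le_eLpNorm_grad {w : EuclideanSpace ℝ (Fin N) → ℝ}
    {Dw : EuclideanSpace ℝ (Fin N) → EuclideanSpace ℝ (Fin N)} (hw : MemH10 Ω w Dw)
    (hN : 0 < N) {p : NNReal} (hp : (p : ℝ)⁻¹ = 2⁻¹ - (N : ℝ)⁻¹) :
    eLpNorm w p (volume.restrict Ω)
      ≤ SNormLESNormFDerivOfEqConst ℝ (volume : Measure (EuclideanSpace ℝ (Fin N))) 2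
        * eLpNorm Dw 2 (volume.restrict Ω) := by
  obtain ⟨ψ, hψ, hψw, hψD⟩ := hw.exists_approx
  set C := SNormLESNormFDerivOfEqConst ℝ (volume : Measure (EuclideanSpace ℝ (Fin N))) 2
  have hψm : ∀ n, AEStronglyMeasurable (ψ n) (volume.restrict Ω) := fun n =>
    (hψ n).smooth.continuous.aestronglyMeasurable
  have hgc : ∀ n, Continuous (∇ (ψ n)) := fun n =>
    (InnerProductSpace.toDual ℝ _).symm.continuous.comp
      ((hψ n).smooth.continuous_fderiv (by simp))
  have hsob : ∀ n, eLpNorm (ψ n) p (volume.restrict Ω)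
      ≤ C * (eLpNorm Dw 2 (volume.restrict Ω)
        + eLpNorm (fun x => Dw x - ∇ (ψ n) x) 2 (volume.restrict Ω)) := by
    intro n
    have h1 := eLpNorm_le_eLpNorm_fderiv_of_eq (μ := volume) (p := 2) (p' := p)
      ((hψ n).smooth.of_le (by simp)) (hψ n).compactSupport one_le_two (by simpa using hN)
      (by simpa using hp)
    have h2 : eLpNorm (fderiv ℝ (ψ n)) 2 volume = eLpNorm (∇ (ψ n)) 2 (volume.restrict Ω) := by
      rw [eLpNorm_restrict_eq_of_support_subset]
      · exact eLpNorm_congr_norm_ae (ae_of_all _ fun x => (norm_gradient_eq _ _).symm)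
      · intro x hx
        by_contra h
        exact hx (by simp [gradient, (hψ n).fderiv_eq_zero_of_notMem h])
    refine (eLpNorm_restrict_le _ _ _ _).trans (h1.trans ?_)
    refine mul_le_mul_right (h2.trans_le ?_) _
    have h3 : ∇ (ψ n) = Dw - fun x => Dw x - ∇ (ψ n) x := by ext1 x; simp
    conv_lhs => rw [h3]
    exact eLpNorm_sub_le hw.memLp_grad.1
      (hw.memLp_grad.1.sub (hgc n).aestronglyMeasurable) one_le_two
  -- L² convergence yields an a.e. convergent subsequence; Fatou's lemma then carries the smooth
  -- Sobolev inequality to the limit.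
  have hmeas : TendstoInMeasure (volume.restrict Ω) ψ atTop w := by
    refine tendstoInMeasure_of_tendsto_eLpNorm two_ne_zero hψm hw.memLp.1 ?_
    refine hψw.congr fun n => ?_
    rw [eLpNorm_sub_comm]; rfl
  obtain ⟨ns, hns, hae⟩ := hmeas.exists_seq_tendsto_ae
  refine (Lp.eLpNorm_lim_le_liminf_eLpNorm (fun n => hψm (ns n)) w hae).trans ?_
  have hlim : Tendsto (fun n => C * (eLpNorm Dw 2 (volume.restrict Ω)
      + eLpNorm (fun x => Dw x - ∇ (ψ (ns n)) x) 2 (volume.restrict Ω))) atTop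
      (𝓝 (C * (eLpNorm Dw 2 (volume.restrict Ω) + 0))) :=
    ENNReal.Tendsto.const_mul (tendsto_const_nhds.add (hψD.comp hns.tendsto_atTop))
      (Or.inr ENNReal.coe_ne_top)
  rw [add_zero] at hlim
  rw [← hlim.liminf_eq]
  exact liminf_le_liminf (Eventually.of_forall fun n => hsob (ns n))

end TestFunctions

/-! ### The pointwise comparison inequality -/

section Pointwise

/-- Powers at least 2 of the positive part are C¹ even at the corner, so the C¹ chain rule covers
the truncations f² and f³. -/
theorem hasDerivAt_max_sub_pow (k : ℝ) (n : ℕ) (s : ℝ) :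
    HasDerivAt (fun s : ℝ => max (s - k) 0 ^ (n + 2)) ((n + 2) * max (s - k) 0 ^ (n + 1)) s := by
  rcases lt_trichotomy s k with h | h | h
  · have h0 : (fun s : ℝ => max (s - k) 0 ^ (n + 2)) =ᶠ[𝓝 s] fun _ => 0 := by
      filter_upwards [gt_mem_nhds h] with y hy
      rw [max_eq_right (by linarith)]; simp
    rw [max_eq_right (by linarith)]
    simpa using (hasDerivAt_const s (0 : ℝ)).congr_of_eventuallyEq h0
  · subst h
    have h1 : (fun x : ℝ => (x - s) ^ (n + 2)) =o[𝓝 s] fun x => x - s := by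
      have := (Asymptotics.isLittleO_pow_id (𝕜 := ℝ) (n := n + 2) (by omega)).comp_tendsto
        (k := fun x : ℝ => x - s) (l' := 𝓝 s) (by
          have h2 : Continuous fun x : ℝ => x - s := by fun_prop
          simpa using h2.tendsto s)
      exact this
    rw [hasDerivAt_iff_isLittleO]
    refine Asymptotics.IsBigO.trans_isLittleO (Asymptotics.IsBigO.of_bound 1
      (Eventually.of_forall fun x => ?_)) h1
    simp only [sub_self, max_self, one_mul]
    have h2 : max (x - s) 0 ≤ |x - s| := max_le (le_abs_self _) (abs_nonneg _)
    simpa [abs_of_nonneg (le_max_right (x - s) 0)] using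
      pow_le_pow_left₀ (le_max_right _ _) h2 (n + 2)
  · have h0 : (fun s : ℝ => max (s - k) 0 ^ (n + 2)) =ᶠ[𝓝 s] fun s => (s - k) ^ (n + 2) := by
      filter_upwards [lt_mem_nhds h] with y hy
      rw [max_eq_left (by linarith)]
    rw [max_eq_left (by linarith)]
    refine HasDerivAt.congr_of_eventuallyEq ?_ h0
    simpa using! ((hasDerivAt_id s).sub_const k).pow (n + 2)

/-- The algebraic inequality behind the comparison principle. Here `s, t` are the values of a sub-
and of a supersolution, `a, b` those of their gradients, and `f` is a truncation of
`s ^ (1 - σ) - t ^ (1 - σ)`. -/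
theorem comparison_pointwise {V : Type*} [NormedAddCommGroup V] [InnerProductSpace ℝ V]
    {σ s t gs gt h f : ℝ} {a b : V} (hσ : σ ∈ Ioo (0 : ℝ) 1) (hs : 0 < s) (ht : 0 < t)
    (hh : 0 ≤ h) (hf : 0 ≤ f) (hts : 0 < f → t < s) (hmono : t < s → t * gt ≤ s * gs)
    (hgs : gs ≤ σ / s) :
    3 / 4 * ‖(2 * f) • (((1 - σ) * s ^ (-σ)) • a - ((1 - σ) * t ^ (-σ)) • b)‖ ^ 2
      - 1 / 2 * (t ^ (σ - 1) * (σ - t * gt) * (‖s ^ (-σ) • a‖ + ‖t ^ (-σ) • b‖) * f ^ 2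
        * ‖(2 * f) • (((1 - σ) * s ^ (-σ)) • a - ((1 - σ) * t ^ (-σ)) • b)‖)
      ≤ (1 - σ) * (
        inner ℝ a (f ^ 3 • (-σ * s ^ (-σ - 1)) • a
          + s ^ (-σ) • (3 * f ^ 2) • (((1 - σ) * s ^ (-σ)) • a - ((1 - σ) * t ^ (-σ)) • b))
        + gs * ‖a‖ ^ 2 * (s ^ (-σ) * f ^ 3) - h * (s ^ (-σ) * f ^ 3)
        - inner ℝ b (f ^ 3 • (-σ * t ^ (-σ - 1)) • b
          + t ^ (-σ) • (3 * f ^ 2) • (((1 - σ) * s ^ (-σ)) • a - ((1 - σ) * t ^ (-σ)) • b))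
        - gt * ‖b‖ ^ 2 * (t ^ (-σ) * f ^ 3) + h * (t ^ (-σ) * f ^ 3)) := by
  obtain ⟨hσ0, hσ1⟩ := hσ
  rcases hf.eq_or_lt with rfl | hf0
  · simp
  have hlt := hts hf0
  have hst := hmono hlt
  set A := s ^ (-σ) with hA
  set C := t ^ (-σ) with hC
  have hA0 : 0 < A := Real.rpow_pos_of_pos hs _
  have hC0 : 0 < C := Real.rpow_pos_of_pos ht _
  have hAC : A ≤ C := Real.rpow_le_rpow_of_nonpos ht hlt.le (by linarith)
  have hs1 : s ^ (-σ - 1) = A / s := by rw [Real.rpow_sub hs, Real.rpow_one]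
  have ht1 : t ^ (-σ - 1) = C / t := by rw [Real.rpow_sub ht, Real.rpow_one]
  have hs2 : s ^ (σ - 1) = 1 / (A * s) := by
    rw [Real.rpow_sub hs, Real.rpow_one, hA, Real.rpow_neg hs.le]; field_simp
  have ht2 : t ^ (σ - 1) = 1 / (C * t) := by
    rw [Real.rpow_sub ht, Real.rpow_one, hC, Real.rpow_neg ht.le]; field_simp
  have hst2 : s ^ (σ - 1) ≤ t ^ (σ - 1) := Real.rpow_le_rpow_of_nonpos ht hlt.le (by linarith)
  have hs3 : 0 ≤ σ - s * gs := by
    rw [le_div_iff₀ hs] at hgs; linarith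
  set Hs := s ^ (σ - 1) * (σ - s * gs) with hHs
  set Ht := t ^ (σ - 1) * (σ - t * gt) with hHt
  -- For t < s both factors decrease from t to s; σ - s g ≥ 0 is what permits multiplying the two
  -- inequalities.
  have hHst : Hs ≤ Ht := by
    rw [hHs, hHt]
    exact mul_le_mul hst2 (by linarith) hs3 (Real.rpow_nonneg ht.le _)
  have hHs0 : 0 ≤ Hs := mul_nonneg (Real.rpow_nonneg hs.le _) hs3
  set P := A • a with hP
  set Q := C • b with hQ
  have hDz : ((1 - σ) * A) • a - ((1 - σ) * C) • b = (1 - σ) • (P - Q) := by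
    rw [smul_sub, hP, hQ, smul_smul, smul_smul]
  have hPn : ‖P‖ ^ 2 = A ^ 2 * ‖a‖ ^ 2 := by
    rw [hP, norm_smul, Real.norm_of_nonneg hA0.le]; ring
  have hQn : ‖Q‖ ^ 2 = C ^ 2 * ‖b‖ ^ 2 := by
    rw [hQ, norm_smul, Real.norm_of_nonneg hC0.le]; ring
  have hPQ : ‖P - Q‖ ^ 2 = A * inner ℝ a (P - Q) - C * inner ℝ b (P - Q) := by
    rw [← real_inner_self_eq_norm_sq]
    nth_rewrite 1 [inner_sub_left]
    nth_rewrite 1 [hP]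
    nth_rewrite 2 [hQ]
    rw [real_inner_smul_left, real_inner_smul_left]
  have htri : ‖P‖ - ‖Q‖ ≤ ‖P - Q‖ := norm_sub_norm_le P Q
  rw [hDz, hs1, ht1, norm_smul, norm_smul, Real.norm_of_nonneg (by positivity : 0 ≤ 2 * f),
    Real.norm_of_nonneg (by linarith : 0 ≤ 1 - σ)]
  simp only [inner_add_right, real_inner_smul_right, real_inner_self_eq_norm_sq]
  -- Differentiating the weight s^(-σ) produces a quadratic term that merges with the one from the
  -- equation.
  have ea : gs * ‖a‖ ^ 2 * (A * f ^ 3) + f ^ 3 * (-σ * (A / s) * ‖a‖ ^ 2)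
      = - (f ^ 3 * (Hs * ‖P‖ ^ 2)) := by
    rw [hPn, hHs, hs2]; field_simp; ring
  have eb : gt * ‖b‖ ^ 2 * (C * f ^ 3) + f ^ 3 * (-σ * (C / t) * ‖b‖ ^ 2)
      = - (f ^ 3 * (Ht * ‖Q‖ ^ 2)) := by
    rw [hQn, hHt, ht2]; field_simp; ring
  have h1 : Hs * ‖P‖ ^ 2 - Ht * ‖Q‖ ^ 2 ≤ Ht * ((‖P‖ + ‖Q‖) * ‖P - Q‖) := by
    have e1 : Hs * ‖P‖ ^ 2 ≤ Ht * ‖P‖ ^ 2 := mul_le_mul_of_nonneg_right hHst (sq_nonneg _)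
    have e2 : (‖P‖ + ‖Q‖) * (‖P‖ - ‖Q‖) ≤ (‖P‖ + ‖Q‖) * ‖P - Q‖ :=
      mul_le_mul_of_nonneg_left htri (by positivity)
    have e3 := mul_le_mul_of_nonneg_left e2 (hHs0.trans hHst)
    linarith [e1, e3]
  have h2 : 0 ≤ h * f ^ 3 * (C - A) := by
    have := sub_nonneg.2 hAC
    positivity
  have h3 := mul_le_mul_of_nonneg_left h1 (by positivity : 0 ≤ f ^ 3)
  have h4 : 0 ≤ (1 - σ) * (f ^ 3 * (Ht * ((‖P‖ + ‖Q‖) * ‖P - Q‖))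
      - f ^ 3 * (Hs * ‖P‖ ^ 2 - Ht * ‖Q‖ ^ 2) + h * f ^ 3 * (C - A)) :=
    mul_nonneg (by linarith) (by linarith)
  have h5 : A * inner ℝ a (P - Q) = ‖P - Q‖ ^ 2 + C * inner ℝ b (P - Q) := by linarith
  rw [← sub_nonneg]
  refine h4.trans_eq ?_
  linear_combination (-(1 - σ)) * ea + (1 - σ) * eb - 3 * f ^ 2 * (1 - σ) ^ 2 * h5

end Pointwise

/-! ### Measurability of superpositions -/

section Caratheodory

variable {N : ℕ} {Ω : Set (EuclideanSpace ℝ (Fin N))}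

/-- The superposition of a Carathéodory function with a measurable function is measurable. -/
theorem IsCaratheodoryFun.aemeasurable_comp {g : EuclideanSpace ℝ (Fin N) → ℝ → ℝ}
    (hg : IsCaratheodoryFun Ω g) {w : EuclideanSpace ℝ (Fin N) → ℝ}
    (hw : AEMeasurable w (volume.restrict Ω)) (hw0 : ∀ᵐ x ∂volume.restrict Ω, 0 < w x) :
    AEMeasurable (fun x => g x (w x)) (volume.restrict Ω) := by
  -- Rounding w up to a multiple of 1/(n+1) gives countably many values. Rounding up keeps them
  -- positive, where g is known to be measurable in x; m = 0 below gets a dummy function.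
  set k : ℕ → EuclideanSpace ℝ (Fin N) → ℕ := fun n x => ⌈w x * (n + 1 : ℝ)⌉₊ with hk
  have hkpos : ∀ n x, 0 < w x → 0 < k n x := fun n x hx => Nat.ceil_pos.2 (by positivity)
  have hkm : ∀ n, AEMeasurable (k n) (volume.restrict Ω) := fun n =>
    Nat.measurable_ceil.comp_aemeasurable (hw.mul_const _)
  refine aemeasurable_of_tendsto_metrizable_ae atTop
    (f := fun (n : ℕ) x => g x ((k n x : ℝ) / (n + 1))) (fun n => ?_) ?_
  · have hm : ∀ m : ℕ, ∃ f : EuclideanSpace ℝ (Fin N) → ℝ, Measurable f ∧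
        (0 < m → (fun x => g x ((m : ℝ) / (n + 1))) =ᵐ[volume.restrict Ω] f) := by
      intro m
      rcases Nat.eq_zero_or_pos m with rfl | hm
      · exact ⟨0, measurable_zero, fun h => absurd h (lt_irrefl 0)⟩
      · have h := hg.aemeasurable ((m : ℝ) / (n + 1)) (by positivity)
        exact ⟨h.mk _, h.measurable_mk, fun _ => h.ae_eq_mk⟩
    choose f hf hfg using hm
    have hF : Measurable fun q : ℕ × EuclideanSpace ℝ (Fin N) => f q.1 q.2 :=
      measurable_from_prod_countable_right fun m => hf m
    refine ⟨fun x => f ((hkm n).mk _ x) x,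
      hF.comp ((hkm n).measurable_mk.prodMk measurable_id), ?_⟩
    have hall : ∀ᵐ x ∂volume.restrict Ω, ∀ m : ℕ, 0 < m → g x ((m : ℝ) / (n + 1)) = f m x := by
      refine ae_all_iff.2 fun m => ?_
      rcases Nat.eq_zero_or_pos m with rfl | hm
      · exact ae_of_all _ fun x h => absurd h (lt_irrefl 0)
      · filter_upwards [hfg m hm] with x hx _ using hx
    filter_upwards [hall, (hkm n).ae_eq_mk, hw0] with x hx hkx hwx
    rw [← hkx]
    exact hx _ (hkpos n x hwx)
  · filter_upwards [hg.continuousOn, hw0] with x hx hwx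
    have h1 : Tendsto (fun n : ℕ => (k n x : ℝ) / (n + 1)) atTop (𝓝 (w x)) :=
      (tendsto_nat_ceil_mul_div_atTop hwx.le).comp
        (tendsto_atTop_add_const_right _ (1 : ℝ) tendsto_natCast_atTop_atTop)
    exact (hx.continuousAt (Ioi_mem_nhds hwx)).tendsto.comp h1

end Caratheodory

/-! ### Vanishing under a small drift -/

section Drift

variable {N : ℕ} {Ω : Set (EuclideanSpace ℝ (Fin N))}

/-- A function in `H¹₀(Ω)` whose energy is controlled by a drift term with a coefficient that is
small in `L^N` on the support of the gradient vanishes. -/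
theorem MemH10.ae_eq_zero_of_drift {w : EuclideanSpace ℝ (Fin N) → ℝ}
    {Dw : EuclideanSpace ℝ (Fin N) → EuclideanSpace ℝ (Fin N)} (hw : MemH10 Ω w Dw)
    (hN : 3 ≤ N) {B : EuclideanSpace ℝ (Fin N) → ℝ} (hB : AEStronglyMeasurable B (volume.restrict Ω))
    (hsmall : SNormLESNormFDerivOfEqConst ℝ (volume : Measure (EuclideanSpace ℝ (Fin N))) 2
      * eLpNorm B N (volume.restrict Ω) ≤ 1)
    (henergy : 3 / 4 * ∫ x in Ω, ‖Dw x‖ ^ 2 ≤ 1 / 2 * ∫ x in Ω, B x * w x * ‖Dw x‖) :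
    w =ᵐ[volume.restrict Ω] 0 := by
  set μ := volume.restrict Ω
  have hN' : (3 : ℝ) ≤ N := by exact_mod_cast hN
  have hinv : (0 : ℝ) < 2⁻¹ - (N : ℝ)⁻¹ := by
    rw [sub_pos]
    exact inv_strictAnti₀ (by norm_num) (by linarith)
  -- The Sobolev exponent 2N/(N-2), finite because N ≥ 3; Hölder pairs it with N to give 2.
  set p : NNReal := ⟨(2⁻¹ - (N : ℝ)⁻¹)⁻¹, by positivity⟩ with hp
  have hpinv : (p : ℝ)⁻¹ = 2⁻¹ - (N : ℝ)⁻¹ := by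
    change ((2⁻¹ - (N : ℝ)⁻¹)⁻¹)⁻¹ = _
    rw [inv_inv]
  have hp0 : p ≠ 0 := by
    intro h
    rw [h] at hpinv
    simp only [NNReal.coe_zero, inv_zero] at hpinv
    linarith
  have hsob := hw.eLpNorm_le_eLpNorm_grad (by omega) hpinv
  set C := SNormLESNormFDerivOfEqConst ℝ (volume : Measure (EuclideanSpace ℝ (Fin N))) 2
  set T := eLpNorm Dw 2 μ with hT
  have hTtop : T ≠ ⊤ := hw.memLp_grad.eLpNorm_ne_top
  have hhol : ENNReal.HolderTriple (N : ℝ≥0∞) (p : ℝ≥0∞) 2 := ⟨by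
    have h1 : ((N : NNReal)⁻¹ + p⁻¹ : NNReal) = 2⁻¹ := by
      apply NNReal.eq
      push_cast
      rw [hpinv]; ring
    have hN0 : (N : NNReal) ≠ 0 := by exact_mod_cast (by omega : N ≠ 0)
    rw [← ENNReal.coe_natCast, ← ENNReal.coe_inv hN0, ← ENNReal.coe_inv hp0, ← ENNReal.coe_add, h1,
      ENNReal.coe_inv two_ne_zero]
    rfl⟩
  have hBw : eLpNorm (fun x => B x * w x) 2 μ ≤ T := by
    have h1 : eLpNorm (B • w) 2 μ ≤ eLpNorm B N μ * eLpNorm w p μ :=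
      eLpNorm_smul_le_mul_eLpNorm hw.memLp.1 hB
    refine (h1.trans (mul_le_mul_right hsob _)).trans ?_
    rw [← mul_assoc, mul_comm (eLpNorm B N μ)]
    exact (mul_le_mul_left hsmall T).trans_eq (one_mul T)
  have hint : ∫⁻ x, ‖B x * w x * ‖Dw x‖‖ₑ ∂μ ≤ T ^ 2 := by
    have h1 : eLpNorm ((fun x => B x * w x) • fun x => ‖Dw x‖) 1 μ
        ≤ eLpNorm (fun x => B x * w x) 2 μ * eLpNorm (fun x => ‖Dw x‖) 2 μ :=
      eLpNorm_smul_le_mul_eLpNorm hw.memLp_grad.1.norm (hB.mul hw.memLp.1)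
    rw [eLpNorm_one_eq_lintegral_enorm, eLpNorm_norm] at h1
    rw [sq]
    exact h1.trans (mul_le_mul_left hBw T)
  have hsq : ∫ x, ‖Dw x‖ ^ 2 ∂μ = T.toReal ^ 2 := by
    have h1 := hw.memLp_grad.eLpNorm_eq_integral_rpow_norm two_ne_zero ENNReal.ofNat_ne_top
    rw [hT, h1, ENNReal.toReal_ofReal (by positivity)]
    simp only [ENNReal.toReal_ofNat, Real.rpow_ofNat]
    rw [← Real.rpow_natCast, ← Real.rpow_mul (integral_nonneg fun x => by positivity)]
    simp [μ]
  have hle : ∫ x, B x * w x * ‖Dw x‖ ∂μ ≤ T.toReal ^ 2 := by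
    rw [← ENNReal.toReal_pow]
    refine (le_abs_self _).trans ((Real.norm_eq_abs _).symm.trans_le ?_)
    rw [← toReal_enorm]
    exact ENNReal.toReal_mono (by finiteness) ((enorm_integral_le_lintegral_enorm _).trans hint)
  -- The energy inequality now reads (3/4) T² ≤ (1/2) T², with T finite.
  have hT0 : T = 0 := by
    rw [hsq] at henergy
    have : T.toReal ^ 2 = 0 := le_antisymm (by linarith) (sq_nonneg _)
    rcases (ENNReal.toReal_eq_zero_iff T).1 (pow_eq_zero_iff two_ne_zero |>.1 this) with h | h
    · exact h
    · exact absurd h hTtop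
  rw [hT0, mul_zero] at hsob
  exact (eLpNorm_eq_zero_iff hw.memLp.1 (by exact_mod_cast hp0)).1 (le_antisymm hsob zero_le)

end Drift

/-! ### Compact superlevel sets and integrability -/

section Auxiliary

variable {N : ℕ} {Ω K : Set (EuclideanSpace ℝ (Fin N))}
  {Du Dφ : EuclideanSpace ℝ (Fin N) → EuclideanSpace ℝ (Fin N)}

/-- A limit point on the boundary is impossible, since the limsup there is below ε; continuity
handles limit points in Ω. -/
theorem isCompact_superlevel (hΩ : IsOpen Ω) (hΩb : Bornology.IsBounded Ω)
    {z : EuclideanSpace ℝ (Fin N) → ℝ} (hz : ContinuousOn z Ω)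
    (hbdry : ∀ x₀ ∈ frontier Ω, limsup (fun x => (z x : EReal)) (𝓝[Ω] x₀) ≤ 0)
    {ε : ℝ} (hε : 0 < ε) : IsCompact {x ∈ Ω | ε ≤ z x} := by
  refine Metric.isCompact_of_isClosed_isBounded (isClosed_of_closure_subset fun x hx => ?_)
    (hΩb.subset fun x hx => hx.1)
  rw [mem_closure_iff_frequently] at hx
  by_cases hxΩ : x ∈ Ω
  · refine ⟨hxΩ, ?_⟩
    by_contra! h
    refine hx ?_
    filter_upwards [(hz.continuousAt (hΩ.mem_nhds hxΩ)).eventually (gt_mem_nhds h)] with y hy hyS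
    exact absurd hyS.2 (not_le.2 hy)
  · exfalso
    have hxf : x ∈ frontier Ω := by
      rw [hΩ.frontier_eq]
      exact ⟨mem_closure_iff_frequently.2 (hx.mono fun y hy => hy.1), hxΩ⟩
    have h1 : limsup (fun x => (z x : EReal)) (𝓝[Ω] x) < (ε : EReal) :=
      (hbdry x hxf).trans_lt (by exact_mod_cast hε)
    refine hx ?_
    filter_upwards [eventually_nhdsWithin_iff.1 (eventually_lt_of_limsup_lt h1)] with y hy hyS
    exact absurd hyS.2 (not_le.2 (by exact_mod_cast hy hyS.1))

/-- Continuity of the finite measure from above, combined with absolute continuity of the L^p norm.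
-/
theorem exists_eLpNorm_indicator_le_of_antitone {α F : Type*} [MeasurableSpace α]
    [NormedAddCommGroup F] {μ : Measure α} [IsFiniteMeasure μ] {f : α → F} {p : ℝ≥0∞}
    (hp : 1 ≤ p) (hp' : p ≠ ⊤) (hf : MemLp f p μ) {A : ℕ → Set α} (hA : Antitone A)
    (hAm : ∀ n, MeasurableSet (A n)) (hA0 : ⋂ n, A n = ∅) {δ : ℝ} (hδ : 0 < δ) :
    ∃ n, eLpNorm ((A n).indicator f) p μ ≤ ENNReal.ofReal δ := by
  obtain ⟨η, hη, h⟩ := hf.eLpNorm_indicator_le hp hp' hδ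
  have hlim := tendsto_measure_iInter_atTop (μ := μ) (fun n => (hAm n).nullMeasurableSet) hA
    ⟨0, measure_ne_top _ _⟩
  rw [hA0, measure_empty] at hlim
  obtain ⟨n, hn⟩ := ((tendsto_order.1 hlim).2 (ENNReal.ofReal η) (by simpa using hη)).exists
  exact ⟨n, h _ (hAm n) hn.le⟩

theorem integrableOn_of_eq_zero_off (hΩ : IsOpen Ω) {F : EuclideanSpace ℝ (Fin N) → ℝ}
    (hF : IntegrableOn F K volume) (hFK : ∀ x ∈ Ω, x ∉ K → F x = 0) : IntegrableOn F Ω volume :=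
  hF.of_forall_sdiff_eq_zero hΩ.measurableSet fun x hx => hFK x hx.1 hx.2

theorem integrableOn_inner (hΩ : IsOpen Ω) (hK : IsCompact K) (hKΩ : K ⊆ Ω)
    (hu : MemLpLoc Ω 2 Du) (hφ : MemLpLoc Ω 2 Dφ) (hφK : ∀ x ∈ Ω, x ∉ K → Dφ x = 0) :
    IntegrableOn (fun x => inner ℝ (Du x) (Dφ x)) Ω volume := by
  refine integrableOn_of_eq_zero_off (K := K) hΩ ?_ fun x hx hxK => by simp [hφK x hx hxK]
  have h1 := ((hu K hK hKΩ).norm.integrable_mul (hφ K hK hKΩ).norm)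
  refine h1.mono' ((hu K hK hKΩ).1.inner (hφ K hK hKΩ).1) (ae_of_all _ fun x => ?_)
  exact norm_inner_le_norm _ _

theorem integrableOn_mul_continuousOn (hΩ : IsOpen Ω) (hK : IsCompact K) (hKΩ : K ⊆ Ω)
    {h φ : EuclideanSpace ℝ (Fin N) → ℝ} (hh : LocallyIntegrableOn h Ω volume)
    (hφ : ContinuousOn φ Ω) (hφK : ∀ x ∈ Ω, x ∉ K → φ x = 0) :
    IntegrableOn (fun x => h x * φ x) Ω volume :=
  integrableOn_of_eq_zero_off (K := K) hΩ
    ((hh.integrableOn_compact_subset hKΩ hK).mul_continuousOn (hφ.mono hKΩ) hK)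
    fun x hx hxK => by simp [hφK x hx hxK]

theorem locallyIntegrableOn_mul_norm_sq (hΩ : IsOpen Ω) (hu : MemLpLoc Ω 2 Du)
    {G β : EuclideanSpace ℝ (Fin N) → ℝ} (hG : AEMeasurable G (volume.restrict Ω))
    (hβ : ContinuousOn β Ω) (hGβ : ∀ᵐ x ∂volume.restrict Ω, |G x| ≤ β x) :
    LocallyIntegrableOn (fun x => G x * ‖Du x‖ ^ 2) Ω volume := by
  rw [locallyIntegrableOn_iff hΩ.isLocallyClosed]
  intro K hKΩ hK
  have h1 := (hu K hK hKΩ).integrable_norm_pow two_ne_zero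
  obtain ⟨C, hC⟩ := hK.exists_bound_of_continuousOn (hβ.mono hKΩ)
  refine h1.bdd_mul (c := C) (hG.mono_set hKΩ).aestronglyMeasurable ?_
  filter_upwards [ae_restrict_of_ae_restrict_of_subset hKΩ hGβ,
    ae_restrict_mem hK.measurableSet] with x hx hxK
  exact hx.trans ((le_abs_self _).trans (hC x hxK))

end Auxiliary

/-! ### Drift coefficient and energy estimate -/

section Comparison

variable {N : ℕ} {Ω : Set (EuclideanSpace ℝ (Fin N))}

theorem IsContSobolev.rpow {u : EuclideanSpace ℝ (Fin N) → ℝ}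
    {Du : EuclideanSpace ℝ (Fin N) → EuclideanSpace ℝ (Fin N)} {p : ℝ≥0∞} (hΩ : IsOpen Ω)
    (hu : IsContSobolev Ω p u Du) (hu0 : ∀ x ∈ Ω, 0 < u x) (r : ℝ) :
    IsContSobolev Ω p (fun x => u x ^ r) (fun x => (r * u x ^ (r - 1)) • Du x) :=
  hu.comp hΩ isOpen_Ioi hu0 (fun _ hs => Real.hasDerivAt_rpow_const (Or.inl (ne_of_gt hs)))
    (continuousOn_const.mul (continuousOn_id.rpow_const fun _ hs => Or.inl (ne_of_gt hs)))

theorem abs_le_of_natural_growth {σ s g g₀ : ℝ} (hσ : 0 < σ) (hs : 0 < s) (h1 : -g₀ ≤ g)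
    (h2 : g ≤ σ / s) : |g| ≤ |g₀| + σ / s := by
  have h3 : 0 < σ / s := by positivity
  rw [abs_le]
  exact ⟨by linarith [le_abs_self g₀], by linarith [abs_nonneg g₀]⟩

theorem ContinuousOn.rpow_pos {X : Type*} [TopologicalSpace X] {S : Set X} {w : X → ℝ}
    (hw : ContinuousOn w S) (hw0 : ∀ x ∈ S, 0 < w x) (r : ℝ) :
    ContinuousOn (fun x => w x ^ r) S :=
  hw.rpow_const fun x hx => Or.inl (hw0 x hx).ne'

theorem integral_alternating_sum_nonpos {α : Type*} [MeasurableSpace α] {μ : Measure α}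
    {a b c a' b' c' : α → ℝ} (ha : Integrable a μ) (hb : Integrable b μ) (hc : Integrable c μ)
    (ha' : Integrable a' μ) (hb' : Integrable b' μ) (hc' : Integrable c' μ)
    (h : ∫ x, a x ∂μ + ∫ x, b x ∂μ ≤ ∫ x, c x ∂μ)
    (h' : ∫ x, c' x ∂μ ≤ ∫ x, a' x ∂μ + ∫ x, b' x ∂μ) :
    ∫ x, (a x + b x - c x - a' x - b' x + c' x) ∂μ ≤ 0 := by
  have e : ∫ x, (a + b - c - a' - b' + c') x ∂μ ≤ 0 := by
    rw [integral_add' ((((ha.add hb).sub hc).sub ha').sub hb') hc',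
      integral_sub' (((ha.add hb).sub hc).sub ha') hb', integral_sub' ((ha.add hb).sub hc) ha',
      integral_sub' (ha.add hb) hc, integral_add' ha hb]
    linarith
  exact e

/-- The drift coefficient of the linearised inequality is as integrable as the gradients. -/
theorem drift_memLpLoc (hΩ : IsOpen Ω) {g : EuclideanSpace ℝ (Fin N) → ℝ → ℝ}
    (hg : IsCaratheodoryFun Ω g) {σ : ℝ} (hσ : 0 < σ) {g₀ : ℝ → ℝ}
    (hg₀ : ContinuousOn g₀ (Ioi 0))
    (hg_bound : ∀ᵐ x ∂volume.restrict Ω, ∀ s : ℝ, 0 < s → -g₀ s ≤ g x s ∧ g x s ≤ σ / s)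
    {u v : EuclideanSpace ℝ (Fin N) → ℝ}
    {Du Dv : EuclideanSpace ℝ (Fin N) → EuclideanSpace ℝ (Fin N)} {p : ℝ≥0∞}
    (hu : IsContSobolev Ω p u Du) (hv : IsContSobolev Ω p v Dv)
    (hu_pos : ∀ x ∈ Ω, 0 < u x) (hv_pos : ∀ x ∈ Ω, 0 < v x) :
    MemLpLoc Ω p fun x => v x ^ (σ - 1) * (σ - v x * g x (v x))
        * (‖u x ^ (-σ) • Du x‖ + ‖v x ^ (-σ) • Dv x‖) := by
  intro K hK hKΩ
  have hP := (hu.memLpLoc_grad.continuousOn_smul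
    (hu.continuousOn.rpow_pos hu_pos (-σ)) K hK hKΩ).norm
  have hQ := (hv.memLpLoc_grad.continuousOn_smul
    (hv.continuousOn.rpow_pos hv_pos (-σ)) K hK hKΩ).norm
  have hvm : AEMeasurable v (volume.restrict Ω) := hv.continuousOn.aemeasurable hΩ.measurableSet
  have hgm := hg.aemeasurable_comp hvm
    ((ae_restrict_iff' hΩ.measurableSet).2 (ae_of_all _ hv_pos))
  have hcont : ContinuousOn (fun x => v x ^ (σ - 1) * (σ + v x * (|g₀ (v x)| + σ / v x))) Ω :=
    (hv.continuousOn.rpow_pos hv_pos _).mul (continuousOn_const.add (hv.continuousOn.mul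
      ((hg₀.comp hv.continuousOn hv_pos).abs.add
        (continuousOn_const.div hv.continuousOn fun x hx => (hv_pos x hx).ne'))))
  obtain ⟨C, hC⟩ := hK.exists_bound_of_continuousOn (hcont.mono hKΩ)
  have hm : AEStronglyMeasurable (fun x => v x ^ (σ - 1) * (σ - v x * g x (v x)))
      (volume.restrict K) :=
    (((hvm.pow_const (σ - 1)).mul ((hvm.mul hgm).const_sub σ)).mono_set hKΩ).aestronglyMeasurable
  refine (hP.add hQ).smul (memLp_top_of_bound hm C ?_)
  filter_upwards [ae_restrict_of_ae_restrict_of_subset hKΩ hg_bound,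
    ae_restrict_mem hK.measurableSet] with x hx hxK
  have hv0 := hv_pos x (hKΩ hxK)
  have h1 := abs_le_of_natural_growth hσ hv0 (hx _ hv0).1 (hx _ hv0).2
  refine le_trans ?_ ((le_abs_self _).trans (hC x hxK))
  rw [norm_mul, Real.norm_of_nonneg (Real.rpow_nonneg hv0.le _), Real.norm_eq_abs]
  refine mul_le_mul_of_nonneg_left ((abs_sub _ _).trans ?_) (Real.rpow_nonneg hv0.le _)
  rw [abs_of_pos hσ, abs_mul, abs_of_pos hv0]
  gcongr

/-- The energy estimate for truncations of `u ^ (1 - σ) - v ^ (1 - σ)`, where `u` is a subsolution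
and `v` is a supersolution. -/
theorem comparison_energy (hΩ : IsOpen Ω) {h : EuclideanSpace ℝ (Fin N) → ℝ}
    (hh_loc : LocallyIntegrableOn h Ω volume) (hh_nonneg : ∀ᵐ x ∂volume.restrict Ω, 0 ≤ h x)
    {g : EuclideanSpace ℝ (Fin N) → ℝ → ℝ} (hg : IsCaratheodoryFun Ω g)
    (hg_mono : ∀ᵐ x ∂volume.restrict Ω, MonotoneOn (fun s : ℝ => s * g x s) (Ioi 0))
    {σ : ℝ} (hσ : σ ∈ Ioo (0 : ℝ) 1) {g₀ : ℝ → ℝ} (hg₀ : ContinuousOn g₀ (Ioi 0))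
    (hg_bound : ∀ᵐ x ∂volume.restrict Ω, ∀ s : ℝ, 0 < s → -g₀ s ≤ g x s ∧ g x s ≤ σ / s)
    {u v : EuclideanSpace ℝ (Fin N) → ℝ}
    {Du Dv : EuclideanSpace ℝ (Fin N) → EuclideanSpace ℝ (Fin N)}
    (hu : IsContSobolev Ω 2 u Du) (hv : IsContSobolev Ω 2 v Dv)
    (hu_pos : ∀ x ∈ Ω, 0 < u x) (hv_pos : ∀ x ∈ Ω, 0 < v x)
    (hu_sub : IsWeakSubsolution Ω g h u Du) (hv_super : IsWeakSupersolution Ω g h v Dv)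
    {K : Set (EuclideanSpace ℝ (Fin N))} (hK : IsCompact K) (hKΩ : K ⊆ Ω) {k : ℝ} (hk : 0 ≤ k)
    (hkK : ∀ x ∈ Ω, k < u x ^ (1 - σ) - v x ^ (1 - σ) → x ∈ K)
    {Dz : EuclideanSpace ℝ (Fin N) → EuclideanSpace ℝ (Fin N)}
    (hDz : Dz = fun x => ((1 - σ) * u x ^ (-σ)) • Du x - ((1 - σ) * v x ^ (-σ)) • Dv x)
    {f : EuclideanSpace ℝ (Fin N) → ℝ}
    (hf : f = fun x => max (u x ^ (1 - σ) - v x ^ (1 - σ) - k) 0) :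
    IsAdmissibleTest Ω (fun x => f x ^ 2) (fun x => (2 * f x) • Dz x) ∧
    3 / 4 * ∫ x in Ω, ‖(2 * f x) • Dz x‖ ^ 2
      ≤ 1 / 2 * ∫ x in Ω, v x ^ (σ - 1) * (σ - v x * g x (v x))
        * (‖u x ^ (-σ) • Du x‖ + ‖v x ^ (-σ) • Dv x‖) * f x ^ 2 * ‖(2 * f x) • Dz x‖ := by
  set μ := volume.restrict Ω with hμ
  have hz : IsContSobolev Ω 2 (fun x => u x ^ (1 - σ) - v x ^ (1 - σ)) Dz := by
    have h1 := (hu.rpow hΩ hu_pos (1 - σ)).sub hΩ (hv.rpow hΩ hv_pos (1 - σ))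
    rw [show 1 - σ - 1 = -σ by ring] at h1
    rwa [hDz]
  have hf0 : ∀ x ∈ Ω, x ∉ K → f x = 0 := fun x hx hxK => by
    rw [hf]
    refine max_eq_right ?_
    by_contra! h
    exact hxK (hkK x hx (by linarith))
  have hfnn : ∀ x, 0 ≤ f x := fun x => by rw [hf]; exact le_max_right _ _
  have hfuv : ∀ x ∈ Ω, 0 < f x → v x < u x := fun x hx hfx => by
    rw [hf] at hfx
    simp only [lt_max_iff, lt_self_iff_false, or_false] at hfx
    by_contra! h
    have := Real.rpow_le_rpow (hu_pos x hx).le h (by linarith [hσ.2] : 0 ≤ 1 - σ)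
    linarith
  have hf2 : IsContSobolev Ω 2 (fun x => f x ^ 2) (fun x => (2 * f x) • Dz x) := by
    rw [hf]
    refine hz.comp hΩ isOpen_univ (fun x _ => mem_univ _) (F := fun s => max (s - k) 0 ^ 2)
      (F' := fun s => 2 * max (s - k) 0) (fun s _ => ?_) (Continuous.continuousOn (by fun_prop))
    simpa using hasDerivAt_max_sub_pow k 0 s
  have hf3 : IsContSobolev Ω 2 (fun x => f x ^ 3) (fun x => (3 * f x ^ 2) • Dz x) := by
    rw [hf]
    refine hz.comp hΩ isOpen_univ (fun x _ => mem_univ _) (F := fun s => max (s - k) 0 ^ 3)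
      (F' := fun s => 3 * max (s - k) 0 ^ 2) (fun s _ => ?_)
      (Continuous.continuousOn (by fun_prop))
    refine (hasDerivAt_max_sub_pow k 1 s).congr_deriv ?_
    norm_num
  refine ⟨hf2.isAdmissibleTest hΩ hK hKΩ (fun x hx hxK => by simp [hf0 x hx hxK])
    (fun x hx hxK => by simp [hf0 x hx hxK]) fun x _ => by positivity, ?_⟩
  -- the integrals in the weak formulations are finite
  have hterms : ∀ {w : EuclideanSpace ℝ (Fin N) → ℝ}
      {Dw : EuclideanSpace ℝ (Fin N) → EuclideanSpace ℝ (Fin N)}, IsContSobolev Ω 2 w Dw →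
      (∀ x ∈ Ω, 0 < w x) →
      IsAdmissibleTest Ω (fun x => w x ^ (-σ) * f x ^ 3) (fun x =>
        f x ^ 3 • (-σ * w x ^ (-σ - 1)) • Dw x + w x ^ (-σ) • (3 * f x ^ 2) • Dz x) ∧
      Integrable (fun x => inner ℝ (Dw x)
        (f x ^ 3 • (-σ * w x ^ (-σ - 1)) • Dw x + w x ^ (-σ) • (3 * f x ^ 2) • Dz x)) μ ∧
      Integrable (fun x => g x (w x) * ‖Dw x‖ ^ 2 * (w x ^ (-σ) * f x ^ 3)) μ ∧
      Integrable (fun x => h x * (w x ^ (-σ) * f x ^ 3)) μ := by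
    intro w Dw hw hw0
    have hφ := (hw.rpow hΩ hw0 (-σ)).mul hΩ hf3
    have hφK : ∀ x ∈ Ω, x ∉ K → w x ^ (-σ) * f x ^ 3 = 0 :=
      fun x hx hxK => by simp [hf0 x hx hxK]
    have hDφK : ∀ x ∈ Ω, x ∉ K →
        f x ^ 3 • (-σ * w x ^ (-σ - 1)) • Dw x + w x ^ (-σ) • (3 * f x ^ 2) • Dz x = 0 :=
      fun x hx hxK => by simp [hf0 x hx hxK]
    refine ⟨hφ.isAdmissibleTest hΩ hK hKΩ hφK hDφK fun x hx =>
      mul_nonneg (Real.rpow_nonneg (hw0 x hx).le _) (pow_nonneg (hfnn x) _),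
      integrableOn_inner hΩ hK hKΩ hw.memLpLoc_grad hφ.memLpLoc_grad hDφK, ?_,
      integrableOn_mul_continuousOn hΩ hK hKΩ hh_loc hφ.continuousOn hφK⟩
    have hgm := hg.aemeasurable_comp (hw.continuousOn.aemeasurable hΩ.measurableSet)
      ((ae_restrict_iff' hΩ.measurableSet).2 (ae_of_all _ hw0))
    refine integrableOn_mul_continuousOn hΩ hK hKΩ (locallyIntegrableOn_mul_norm_sq hΩ
      hw.memLpLoc_grad hgm (β := fun x => |g₀ (w x)| + σ / w x) ?_ ?_) hφ.continuousOn hφK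
    · exact (hg₀.comp hw.continuousOn hw0).abs.add
        (continuousOn_const.div hw.continuousOn fun x hx => (hw0 x hx).ne')
    · filter_upwards [hg_bound, ae_restrict_mem hΩ.measurableSet] with x hx hxΩ
      exact abs_le_of_natural_growth hσ.1 (hw0 x hxΩ) (hx _ (hw0 x hxΩ)).1 (hx _ (hw0 x hxΩ)).2
  -- The subsolution is tested with u^(-σ) f³ and the supersolution with v^(-σ) f³. The cube is
  -- chosen so that 3f²|∇z|² = (3/4)|∇(f²)|².
  obtain ⟨ht1, hI1, hG1, hH1⟩ := hterms hu hu_pos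
  obtain ⟨ht2, hI2, hG2, hH2⟩ := hterms hv hv_pos
  have e1 := hu_sub _ _ ht1
  have e2 := hv_super _ _ ht2
  have hJ : ∫ x, (inner ℝ (Du x)
        (f x ^ 3 • (-σ * u x ^ (-σ - 1)) • Du x + u x ^ (-σ) • (3 * f x ^ 2) • Dz x)
      + g x (u x) * ‖Du x‖ ^ 2 * (u x ^ (-σ) * f x ^ 3) - h x * (u x ^ (-σ) * f x ^ 3)
      - inner ℝ (Dv x)
        (f x ^ 3 • (-σ * v x ^ (-σ - 1)) • Dv x + v x ^ (-σ) • (3 * f x ^ 2) • Dz x)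
      - g x (v x) * ‖Dv x‖ ^ 2 * (v x ^ (-σ) * f x ^ 3) + h x * (v x ^ (-σ) * f x ^ 3)) ∂μ ≤ 0 :=
    integral_alternating_sum_nonpos hI1 hG1 hH1 hI2 hG2 hH2 e1 e2
  have hJi := (((((hI1.add hG1).sub hH1).sub hI2).sub hG2).add hH2).const_mul (1 - σ)
  have hRi : Integrable (fun x => v x ^ (σ - 1) * (σ - v x * g x (v x))
      * (‖u x ^ (-σ) • Du x‖ + ‖v x ^ (-σ) • Dv x‖) * f x ^ 2 * ‖(2 * f x) • Dz x‖) μ := by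
    refine integrableOn_of_eq_zero_off (K := K) hΩ ?_ fun x hx hxK => by simp [hf0 x hx hxK]
    have h1 := (drift_memLpLoc hΩ hg hσ.1 hg₀ hg_bound hu hv hu_pos hv_pos K hK hKΩ)
    have h2 := (hf2.memLpLoc_grad.continuousOn_smul hf2.continuousOn K hK hKΩ).norm
    refine (h1.integrable_mul h2).congr (ae_of_all _ fun x => ?_)
    simp only [Pi.mul_apply]
    rw [norm_smul (f x ^ 2), Real.norm_of_nonneg (sq_nonneg (f x)), mul_assoc _ (f x ^ 2)]
  have hLi : Integrable (fun x => ‖(2 * f x) • Dz x‖ ^ 2) μ := by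
    refine integrableOn_of_eq_zero_off (K := K) hΩ ?_ fun x hx hxK => by simp [hf0 x hx hxK]
    exact (hf2.memLpLoc_grad K hK hKΩ).integrable_norm_pow two_ne_zero
  have hmono := integral_mono_ae ((hLi.const_mul (3 / 4)).sub (hRi.const_mul (1 / 2))) hJi (by
    filter_upwards [hh_nonneg, hg_mono, hg_bound, ae_restrict_mem hΩ.measurableSet]
      with x hxh hxm hxb hxΩ
    have hu0 := hu_pos x hxΩ
    have hv0 := hv_pos x hxΩ
    have key := comparison_pointwise (a := Du x) (b := Dv x) hσ hu0 hv0 hxh (hfnn x)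
      (hfuv x hxΩ) (fun hlt => hxm hv0 hu0 hlt.le) (hxb _ hu0).2
    simpa [hDz] using key)
  rw [integral_sub' (hLi.const_mul (3 / 4)) (hRi.const_mul (1 / 2)), integral_const_mul,
    integral_const_mul, integral_const_mul] at hmono
  have := mul_nonpos_of_nonneg_of_nonpos (by linarith [hσ.2] : 0 ≤ 1 - σ) hJ
  refine sub_nonpos.1 (hmono.trans ?_)
  exact this

end Comparison

/-! ### The comparison principle -/

theorem mainTheorem10 {N : ℕ} (hN : 3 ≤ N)
    (Ω : Set (EuclideanSpace ℝ (Fin N)))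
    (hΩ_open : IsOpen Ω) (hΩ_conn : IsConnected Ω) (hΩ_bdd : Bornology.IsBounded Ω)
    (h : EuclideanSpace ℝ (Fin N) → ℝ)
    (hh_loc : LocallyIntegrableOn h Ω volume)
    (hh_nonneg : ∀ᵐ x ∂(volume.restrict Ω), 0 ≤ h x)
    (hh_ne : ¬ ∀ᵐ x ∂(volume.restrict Ω), h x = 0)
    (g : EuclideanSpace ℝ (Fin N) → ℝ → ℝ)
    (hg : IsCaratheodoryFun Ω g)
    (hg_mono : ∀ᵐ x ∂(volume.restrict Ω), MonotoneOn (fun s : ℝ => s * g x s) (Ioi 0))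
    (σ : ℝ) (hσ : σ ∈ Ioo (0 : ℝ) 1)
    (hg_bound : ∃ g₀ : ℝ → ℝ, ContinuousOn g₀ (Ioi 0) ∧
      ∀ᵐ x ∂(volume.restrict Ω), ∀ s : ℝ, 0 < s → -g₀ s ≤ g x s ∧ g x s ≤ σ / s)
    (u v : EuclideanSpace ℝ (Fin N) → ℝ)
    (Du Dv : EuclideanSpace ℝ (Fin N) → EuclideanSpace ℝ (Fin N))
    (hu_cont : ContinuousOn u Ω) (hv_cont : ContinuousOn v Ω)
    (hu_sob : MemW1pLoc Ω (N : ℝ≥0∞) u Du) (hv_sob : MemW1pLoc Ω (N : ℝ≥0∞) v Dv)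
    (hu_pos : ∀ x ∈ Ω, 0 < u x) (hv_pos : ∀ x ∈ Ω, 0 < v x)
    (hu_sub : IsWeakSubsolution Ω g h u Du)
    (hv_super : IsWeakSupersolution Ω g h v Dv)
    (hbdry : ∀ x₀ ∈ frontier Ω,
      limsup (fun x => ((u x ^ (1 - σ) - v x ^ (1 - σ) : ℝ) : EReal)) (𝓝[Ω] x₀) ≤ 0) :
    ∀ x ∈ Ω, u x ≤ v x := by
  obtain ⟨g₀, hg₀, hg_bound⟩ := hg_bound
  have hN2 : (2 : ℝ≥0∞) ≤ N := by exact_mod_cast (by omega : 2 ≤ N)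
  have hu : IsContSobolev Ω N u Du := ⟨hu_cont, hu_sob.hasWeakGradient, hu_sob.memLpLoc_grad⟩
  have hv : IsContSobolev Ω N v Dv := ⟨hv_cont, hv_sob.hasWeakGradient, hv_sob.memLpLoc_grad⟩
  set z : EuclideanSpace ℝ (Fin N) → ℝ := fun x => u x ^ (1 - σ) - v x ^ (1 - σ) with hz
  set Dz : EuclideanSpace ℝ (Fin N) → EuclideanSpace ℝ (Fin N) :=
    fun x => ((1 - σ) * u x ^ (-σ)) • Du x - ((1 - σ) * v x ^ (-σ)) • Dv x with hDz
  have hzS : IsContSobolev Ω N z Dz := by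
    have h1 := (hu.rpow hΩ_open hu_pos (1 - σ)).sub hΩ_open (hv.rpow hΩ_open hv_pos (1 - σ))
    rwa [show 1 - σ - 1 = -σ by ring] at h1
  have hzc := hzS.continuousOn
  by_contra! hcon
  obtain ⟨x₀, hx₀, hlt⟩ := hcon
  have hz₀ : 0 < z x₀ :=
    sub_pos.2 (Real.rpow_lt_rpow (hv_pos x₀ hx₀).le hlt (by linarith [hσ.2]))
  set ε := z x₀ / 2 with hε
  set K := {x ∈ Ω | ε ≤ z x} with hKdef
  have hK : IsCompact K := isCompact_superlevel hΩ_open hΩ_bdd hzc hbdry (half_pos hz₀)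
  have hKΩ : K ⊆ Ω := fun x hx => hx.1
  have hx₀K : x₀ ∈ K := ⟨hx₀, by linarith⟩
  obtain ⟨x₁, hx₁, hmax⟩ := hK.exists_isMaxOn ⟨x₀, hx₀K⟩ (hzc.mono hKΩ)
  set M := z x₁ with hM
  have hM₀ : z x₀ ≤ M := hmax hx₀K
  have hzM : ∀ x ∈ Ω, z x ≤ M := fun x hx => by
    by_cases hxK : x ∈ K
    · exact hmax hxK
    · have : z x < ε := by
        by_contra! h
        exact hxK ⟨hx, h⟩
      linarith
  -- truncation levels increasing to the maximum
  set k : ℕ → ℝ := fun n => M - (M - ε) / (n + 1) with hk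
  have hMε : 0 < M - ε := by linarith
  have hkM : ∀ n, k n < M := fun n => by
    have : 0 < (M - ε) / ((n : ℝ) + 1) := by positivity
    simp only [hk]; linarith
  have hkε : ∀ n, ε ≤ k n := fun n => by
    have : (M - ε) / ((n : ℝ) + 1) ≤ M - ε :=
      div_le_self hMε.le (by linarith [(Nat.cast_nonneg n : (0 : ℝ) ≤ n)])
    simp only [hk]; linarith
  have hkmono : Monotone k := fun m n hmn => by
    have h1 : ((m : ℝ) + 1) ≤ n + 1 := by exact_mod_cast Nat.succ_le_succ hmn
    have h2 : (M - ε) / ((n : ℝ) + 1) ≤ (M - ε) / (m + 1) :=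
      div_le_div_of_nonneg_left hMε.le (by positivity) h1
    simp only [hk]; linarith
  have hklim : Tendsto k atTop (𝓝 M) := by
    have h1 := (tendsto_one_div_add_atTop_nhds_zero_nat (𝕜 := ℝ)).const_mul (M - ε)
    have h2 := h1.const_sub M
    simp only [mul_zero, sub_zero, mul_one_div] at h2
    exact h2
  -- Excluding the level M makes the intersection empty even if {z = M} has positive measure.
  set A : ℕ → Set (EuclideanSpace ℝ (Fin N)) := fun n => Ω ∩ z ⁻¹' Ioo (k n) M with hA
  have hAm : ∀ n, MeasurableSet (A n) := fun n =>
    (hzc.isOpen_inter_preimage hΩ_open isOpen_Ioo).measurableSet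
  have hAK : ∀ n, A n ⊆ K := fun n x hx => ⟨hx.1, (hkε n).trans hx.2.1.le⟩
  have hAanti : Antitone A := fun m n hmn x hx =>
    ⟨hx.1, (hkmono hmn).trans_lt hx.2.1, hx.2.2⟩
  have hA0 : ⋂ n, A n = ∅ := by
    refine eq_empty_of_forall_notMem fun x hx => ?_
    rw [mem_iInter] at hx
    exact absurd (le_of_tendsto' hklim fun n => (hx n).2.1.le) (not_le.2 (hx 0).2.2)
  set b : EuclideanSpace ℝ (Fin N) → ℝ := fun x => v x ^ (σ - 1) * (σ - v x * g x (v x))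
        * (‖u x ^ (-σ) • Du x‖ + ‖v x ^ (-σ) • Dv x‖) with hb
  have hbK : MemLp b N (volume.restrict K) :=
    drift_memLpLoc hΩ_open hg hσ.1 hg₀ hg_bound hu hv hu_pos hv_pos K hK hKΩ
  set C := SNormLESNormFDerivOfEqConst ℝ (volume : Measure (EuclideanSpace ℝ (Fin N))) 2 with hC
  have hfin : IsFiniteMeasure (volume.restrict K) := ⟨by
    rw [Measure.restrict_apply_univ]; exact hK.measure_lt_top⟩
  -- The bound 1/(C+1) makes the product with C at most 1 without requiring C > 0.
  obtain ⟨n, hn⟩ := exists_eLpNorm_indicator_le_of_antitone (one_le_two.trans hN2)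
    (ENNReal.natCast_ne_top N) hbK hAanti hAm hA0 (δ := ((C : ℝ) + 1)⁻¹) (by positivity)
  have hrestr : ∀ S : Set (EuclideanSpace ℝ (Fin N)), A n ⊆ S →
      (volume.restrict S).restrict (A n) = volume.restrict (A n) := fun S hS => by
    rw [Measure.restrict_restrict (hAm n), inter_eq_left.2 hS]
  have hsmall : C * eLpNorm ((A n).indicator b) N (volume.restrict Ω) ≤ 1 := by
    rw [eLpNorm_indicator_eq_eLpNorm_restrict (hAm n), hrestr K (hAK n)] at hn
    rw [eLpNorm_indicator_eq_eLpNorm_restrict (hAm n), hrestr Ω ((hAK n).trans hKΩ)]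
    refine (mul_le_mul_right hn _).trans ?_
    rw [← ENNReal.ofReal_coe_nnreal, ← ENNReal.ofReal_mul C.coe_nonneg, ENNReal.ofReal_le_one,
      ← div_eq_mul_inv, div_le_one (by positivity)]
    linarith
  set f : EuclideanSpace ℝ (Fin N) → ℝ := fun x => max (z x - k n) 0 with hf
  obtain ⟨hadm, hen⟩ := comparison_energy hΩ_open hh_loc hh_nonneg hg hg_mono hσ hg₀ hg_bound
    (hu.mono_exponent hN2) (hv.mono_exponent hN2) hu_pos hv_pos hu_sub hv_super hK hKΩ
    ((half_pos hz₀).le.trans (hkε n)) (fun x hx hxk => ⟨hx, (hkε n).trans hxk.le⟩) hDz hf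
  have hbm : AEStronglyMeasurable ((A n).indicator b) (volume.restrict Ω) := by
    rw [aestronglyMeasurable_indicator_iff (hAm n), hrestr Ω ((hAK n).trans hKΩ)]
    exact hbK.1.mono_measure (Measure.restrict_mono (hAK n) le_rfl)
  have hlevel := hzS.ae_eq_zero_of_level hΩ_open M
  -- Off `A n`, either z ≤ k n, where f = 0, or z = M, where ∇z = 0 almost everywhere.
  have hint : ∫ x in Ω, b x * f x ^ 2 * ‖(2 * f x) • Dz x‖
      = ∫ x in Ω, (A n).indicator b x * f x ^ 2 * ‖(2 * f x) • Dz x‖ := by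
    refine integral_congr_ae ?_
    filter_upwards [hlevel, ae_restrict_mem hΩ_open.measurableSet] with x hx hxΩ
    by_cases hxA : x ∈ A n
    · rw [indicator_of_mem hxA]
    · rw [indicator_of_notMem hxA]
      rcases (hzM x hxΩ).eq_or_lt with h | h
      · simp [hx h]
      · have h1 : z x ≤ k n := by
          by_contra! h2
          exact hxA ⟨hxΩ, h2, h⟩
        have h2 : f x = 0 := max_eq_right (by linarith)
        simp [h2]
  rw [hint] at hen
  have hzero := hadm.memH10.ae_eq_zero_of_drift hN hbm hsmall hen
  have hfc : ContinuousOn (fun x => f x ^ 2) Ω :=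
    ((hzc.sub continuousOn_const).sup continuousOn_const).pow 2
  -- Continuity turns a.e. vanishing of f² into vanishing at the maximum point `x₁`.
  have heq := Measure.eqOn_open_of_ae_eq hzero hΩ_open hfc continuousOn_const (hKΩ hx₁)
  have hf₁ : f x₁ = M - k n := max_eq_left (by linarith [hkM n])
  have : 0 < f x₁ := by rw [hf₁]; linarith [hkM n]
  exact absurd heq (by simpa using this.ne')
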